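/- Let $\mathfrak C$ be a monster model of a complete first-order theory $T$ in a language $\mathcal L$: for some strong limit cardinal $\mu > |T| := |\mathcal L| + \aleph_0$, $\mathfrak C$ is $\mu$-saturated and strongly $\mu$-homogeneous. ``Small'' means of cardinality less than $\mu$. Let $\perp\!\!\!\perp$ (written $A \perp\!\!\!\perp_B D$) be a symmetric independence relation on small subsets of $\mathfrak C$, i.e. one satisfying Invariance, Normality, Symmetry, Transitivity (for $B\subseteq D\subseteq E$: $A\perp\!\!\!\perp_B E$ iff $A\perp\!\!\!\perp_B D$ and $A\perp\!\!\!\perp_D E$), Finite Character, Extension and Local Character. Let $\kappa_0$ be the least regular cardinal $\lambda$ such that for every finite $A$ and small $B$ there is $B_0\subseteq B$ with $|B_0|<\lambda$ and $A\perp\!\!\!\perp_{B_0}B$. Put $\mathrm{cl}(A)=\{c : c\perp\!\!\!\perp_A c\}$. If $p$ is a complete type over $A$, a forking extension of $p$ is a complete type $q$ over a small $B\supseteq A$ that extends $p$ and whose realizations $a$ satisfy $a\not\perp\!\!\!\perp_A B$. Let $U$ be the associated rank: $U(p)\ge\alpha$ iff for every $\beta<\alpha$ there is a forking extension $q$ of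 $p$ with $U(q)\ge\beta$. For a set $X$ definable over a small set $A$, $U(X)$ is the supremum of the ranks of the complete types over $A$ realized in $X$, and $U(\emptyset)=-\infty$. Fix a cardinal $\kappa$ with $\max(\kappa_0,|T|)<\kappa<\mu$. A ($\kappa$-)lovely pair is a pair $(M,P)$, where $M\prec\mathfrak C$ is small and $P\subseteq M$, such that for every $A\subseteq M$ with $|A|<\kappa$ and every complete $\mathcal L$-$1$-type $q$ over $A$: (Density) if $q\perp\!\!\!\perp_{P\cap A}A$, then $q$ is realized in $P$; (Extension) $q$ is realized by some $b\in M$ with $b\perp\!\!\!\perp_A P$. Loveliness is first-order if there is a theory $T'\supseteq T$ in the language $\mathcal L\cup\{P\}$ such that every lovely pair is a model of $T'$ and, for some small $\lambda$, every $\lambda$-saturated pair $(M,P)\models T'$ with $M\prec\mathfrak C$ small and $P\subseteq M$ is lovely. The rank $U$ is definable if for every formula $\varphi(\bar x,\bar y)$ with parameters in a small set $A$ and every $k\in\mathbb N$, the set $\{\bar b : U(\varphi(\mathfrak C,\bar b))=k\}$ is definable over $A$. The closure $\mathrm{cl}$ is definable if for every small $A$ the set $\mathrm{cl}(A)$ is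 a union of sets definable over $A$. **Proposition.** Assume that $\perp\!\!\!\perp$ is superior (i.e. $\kappa_0=\aleph_0$) of rank 1 (i.e. $U(\mathfrak C)=1$). If loveliness is first-order, then $U$ is definable. Moreover, if $\mathrm{cl}$ is definable, then loveliness is first-order if and only if $U$ is definable. -/

import Mathlib

open FirstOrder FirstOrder.Language Cardinal

universe u

namespace LovelyPairs

section Basics

variable (L : FirstOrder.Language.{u, u}) {C : Type u} [L.Structure C]

/-- The tuples `a` and `a'` have the same `L`-type over the parameter set `B` (the elements of `B`
are substituted for the left-hand variables). -/
def SameType (B : Set C) {ι : Type u} (a a' : ι → C) : Prop :=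
  ∀ φ : L.Formula (B ⊕ ι), φ.Realize (Sum.elim (↑) a) ↔ φ.Realize (Sum.elim (↑) a')

/-- The same for two finite tuples. -/
def SameTypeFin (B : Set C) {n : ℕ} (a a' : Fin n → C) : Prop :=
  ∀ φ : L.Formula (B ⊕ Fin n), φ.Realize (Sum.elim (↑) a) ↔ φ.Realize (Sum.elim (↑) a')

/-- The same for two elements. -/
def SameType₁ (B : Set C) (c c' : C) : Prop :=
  SameTypeFin L B (fun _ : Fin 1 => c) (fun _ => c')

/-- `A' ≡_B A`: some enumerations of `A` and `A'` by the same index set have the same type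
over `B`. -/
def SetSameType (B A A' : Set C) : Prop :=
  ∃ f : A → C, Set.range f = A' ∧ SameType L B (fun a : A => (a : C)) f

/-- `M` is `lam`-saturated: every finitely satisfiable partial 1-type over fewer than `lam`
parameters is realized in `M`. -/
def IsSaturated (M : Type u) [L.Structure M] (lam : Cardinal.{u}) : Prop :=
  ∀ A : Set M, #A < lam → ∀ p : Set (L.Formula (A ⊕ Fin 1)),
    (∀ s : Finset (L.Formula (A ⊕ Fin 1)), (s : Set _) ⊆ p →
      ∃ c : M, ∀ φ ∈ s, φ.Realize (Sum.elim (↑) (fun _ => c))) →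
    ∃ c : M, ∀ φ ∈ p, φ.Realize (Sum.elim (↑) (fun _ => c))

/-- `M` is strongly `mu`-homogeneous. -/
def IsStronglyHomogeneous (M : Type u) [L.Structure M] (mu : Cardinal.{u}) : Prop :=
  ∀ (ι : Type u), #ι < mu → ∀ a b : ι → M,
    (∀ φ : L.Formula ι, φ.Realize a ↔ φ.Realize b) → ∃ σ : M ≃[L] M, ∀ i, σ (a i) = b i

/-- The cardinality `|T|` of a theory in the language `L`. -/
noncomputable def theoryCard : Cardinal.{u} := max ℵ₀ L.card

/-- `C` is a monster model (of its complete theory) of monstrosity `mu`. -/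
structure IsMonster (C : Type u) [L.Structure C] (mu : Cardinal.{u}) : Prop where
  strongLimit : mu.IsStrongLimit
  theoryCard_lt : theoryCard L < mu
  saturated : IsSaturated L C mu
  homogeneous : IsStronglyHomogeneous L C mu

end Basics

section Independence

variable (L : FirstOrder.Language.{u, u}) {C : Type u} [L.Structure C] (mu : Cardinal.{u})

/-- The set `A` is small with respect to the monstrosity `mu`. -/
def IsSmall (A : Set C) : Prop := #A < mu

/-- `ind A B D` is read as `A ⫫_B D` (`A` is independent from `D` over `B`); only its values on
small sets matter.  This is the notion of a symmetric independence relation on `C`. -/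
structure IsIndependenceRelation (ind : Set C → Set C → Set C → Prop) : Prop where
  invariance : ∀ A B D : Set C, IsSmall mu A → IsSmall mu B → IsSmall mu D →
    ∀ σ : C ≃[L] C, ind A B D → ind (σ '' A) (σ '' B) (σ '' D)
  normality : ∀ A B D : Set C, IsSmall mu A → IsSmall mu B → IsSmall mu D →
    ind A B D → ind (A ∪ B) B D
  symmetry : ∀ A B D : Set C, IsSmall mu A → IsSmall mu B → IsSmall mu D →
    ind A B D → ind D B A
  transitivity : ∀ A B D E : Set C, IsSmall mu A → IsSmall mu E → B ⊆ D → D ⊆ E →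
    (ind A B E ↔ ind A B D ∧ ind A D E)
  finiteCharacter : ∀ A B D : Set C, IsSmall mu A → IsSmall mu B → IsSmall mu D →
    (ind A B D ↔ ∀ A₀ ⊆ A, A₀.Finite → ind A₀ B D)
  extension : ∀ A B D : Set C, IsSmall mu A → IsSmall mu B → IsSmall mu D →
    ∃ A' : Set C, SetSameType L B A A' ∧ ind A' B D
  localCharacter : ∃ k : Cardinal.{u}, k < mu ∧
    ∀ A D : Set C, IsSmall mu A → IsSmall mu D →
      ∃ D₀ ⊆ D, #D₀ < k + Order.succ #A ∧ ind A D₀ D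

variable (ind : Set C → Set C → Set C → Prop)

/-- `κ₀` is the smallest regular cardinal `k` such that every finite tuple is independent from
every small set `B` over a subset of `B` of cardinality less than `k`. -/
noncomputable def kappaZero : Cardinal.{u} :=
  sInf {k | k.IsRegular ∧ ∀ A B : Set C, A.Finite → IsSmall mu B →
    ∃ B₀ ⊆ B, #B₀ < k ∧ ind A B₀ B}

/-- The independence relation is superior. -/
def IsSuperior : Prop := kappaZero mu ind = ℵ₀

/-- `mcl ind A` is the set of all `c` such that `c ⫫_A c`, for small `A`. -/
def mcl (A : Set C) : Set C := {c | ind {c} A {c}}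

/-- The closure operator is definable: the closure of every small set `A` is a union of sets that
are definable over `A`. -/
def ClosureDefinable : Prop :=
  ∀ A : Set C, IsSmall mu A → ∀ c ∈ mcl ind A, ∃ S : Set C,
    A.Definable₁ L S ∧ c ∈ S ∧ S ⊆ mcl ind A

/-- `U(tp(a/A)) ≥ α`: for every `β < α`, the type `tp(a/A)` has a forking extension
`tp(a'/B)` over a small set `B ⊇ A` with `U(tp(a'/B)) ≥ β`. -/
def RankGE (α : Ordinal.{u}) {n : ℕ} (a : Fin n → C) (A : Set C) : Prop :=
  ∀ β, β < α → ∃ (B : Set C) (a' : Fin n → C), A ⊆ B ∧ IsSmall mu B ∧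
    SameTypeFin L A a a' ∧ ¬ ind (Set.range a') A B ∧ RankGE β a' B
termination_by α

/-- The rank `U(tp(a/A))`, an ordinal or `⊤`. -/
noncomputable def uRank {n : ℕ} (a : Fin n → C) (A : Set C) : WithTop Ordinal.{u} :=
  sSup ((fun α : Ordinal.{u} => (α : WithTop Ordinal.{u})) '' {α | RankGE L mu ind α a A})

/-- The rank `U(X)` of a set `X ⊆ Cⁿ` that is definable over the small set `A`: the supremum of
the ranks of the complete types over `A` that are realized in `X`, with value `⊥` at `∅`. -/
noncomputable def uRankSet {n : ℕ} (X : Set (Fin n → C)) (A : Set C) :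
    WithBot (WithTop Ordinal.{u}) :=
  ⨆ a ∈ X, (uRank L mu ind a A : WithBot (WithTop Ordinal.{u}))

/-- `U` is definable: for every formula `φ(x, y)` with parameters from a small set `A` and every
natural number `k`, the set of all `b` with `U(φ(C, b)) = k` is definable over `A`. -/
def UDefinable : Prop :=
  ∀ A : Set C, IsSmall mu A → ∀ (n m k : ℕ) (φ : L[[A]].Formula (Fin n ⊕ Fin m)),
    A.Definable L {b : Fin m → C |
      uRankSet L mu ind {a : Fin n → C | φ.Realize (Sum.elim a b)} (A ∪ Set.range b)
        = (k : WithBot (WithTop Ordinal.{u}))}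

end Independence

section Pairs

/-- The relation symbols of the language with one unary predicate `P`. -/
inductive PredRel : ℕ → Type
  | P : PredRel 1

/-- The language whose only symbol is the unary predicate `P`. -/
def predLang : FirstOrder.Language.{0, 0} := ⟨fun _ => Empty, PredRel⟩

variable (L : FirstOrder.Language.{u, u}) {C : Type u} [L.Structure C] (mu : Cardinal.{u})
  (ind : Set C → Set C → Set C → Prop)

/-- The language `L² = L ∪ {P}`. -/
abbrev pairLang : FirstOrder.Language.{u, u} := L.sum predLang

variable {L}

/-- The universe `M` of the pair `(M, P)`. -/
def PairModel (M : L.ElementarySubstructure C) (_P : Set C) : Type u := M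

instance (M : L.ElementarySubstructure C) (P : Set C) : L.Structure (PairModel M P) :=
  inferInstanceAs (L.Structure M)

/-- The predicate symbol is interpreted in the pair `(M, P)` as the set of elements of `M` that
belong to `P`. -/
instance (M : L.ElementarySubstructure C) (P : Set C) : predLang.Structure (PairModel M P) where
  funMap := fun f _ => Empty.elim f
  RelMap := fun
    | PredRel.P => fun x => ((show M from x 0) : C) ∈ P

/-- `(M, P)` is a `κ`-lovely pair: `M ≺ C` is a small model and `P ⊆ M`, with the density and
extension properties for complete `L`-1-types over sets of fewer than `κ` elements of `M`.  A type
over `A` is given by one of its realizations `c` in `C`. -/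
structure IsLovely (κ : Cardinal.{u}) (M : L.ElementarySubstructure C) (P : Set C) : Prop where
  small : IsSmall mu (M : Set C)
  subset : P ⊆ M
  density : ∀ A : Set C, A ⊆ M → #A < κ → ∀ c : C, ind {c} (P ∩ A) A →
    ∃ d ∈ P, SameType₁ L A c d
  extension : ∀ A : Set C, A ⊆ M → #A < κ → ∀ c : C,
    ∃ b ∈ M, SameType₁ L A c b ∧ ind {b} A P

variable (L)

/-- `κ`-loveliness is first-order: there is an `L²`-theory `T'` expanding the theory of `C` such
that every `κ`-lovely pair is a model of `T'` and every sufficiently saturated pair (with small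
universe `M ≺ C`) that is a model of `T'` is a `κ`-lovely pair. -/
def LovelinessFirstOrder (κ : Cardinal.{u}) : Prop :=
  ∃ T' : (pairLang L).Theory,
    (LHom.sumInl : L →ᴸ pairLang L).onTheory (L.completeTheory C) ⊆ T' ∧
    (∀ (M : L.ElementarySubstructure C) (P : Set C), IsLovely mu ind κ M P →
      Theory.Model (PairModel M P) T') ∧
    ∃ lam < mu, ∀ (M : L.ElementarySubstructure C) (P : Set C),
      IsSmall mu (M : Set C) → P ⊆ M → Theory.Model (PairModel M P) T' →
      IsSaturated (pairLang L) (PairModel M P) lam → IsLovely mu ind κ M P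

end Pairs

end LovelyPairs

/-!
The closure `cl` of an independence relation `⫫` that is superior of rank 1 is a pregeometry: it
has finite character by superiority, exchange is symmetry, and rank 1 says that an element outside
the closure of `B` is independent from `B` over every subset (`dichotomy_of_uRankSet`). The rank of
a finite tuple is its dimension in this pregeometry (`IsRankOne.rankGE_natCast_iff`). Hence `U` is
definable if and only if the generic quantifier "there is `x ∉ cl(b)` with `φ(b, x)`" can be
eliminated in favour of an `L`-formula in `b` (`GenericDefinable`): in one direction this
quantifier says that `φ(b, C)` has rank 1, and in the other it is iterated to express that some
coordinates of a point are closure-independent.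

The connection with lovely pairs is that for a finite tuple `b` in the predicate `P` of a lovely
pair `(M, P)` the generic quantifier means "there is `x ∈ M` outside `P` with `φ(b, x)`"
(`IsLovely.exists_notMem_mcl_iff`): `P` is closed in `M`, and generic types over `b` are realized
outside `cl(P)`.

Suppose that loveliness is first-order. By compactness the generic quantifier is eliminable if for
every tuple `b` it is decided by a formula true at `b`. Otherwise some tuples `b'` approximate the
type of `b` and disagree with `b` about the generic quantifier. Each of them lies in the predicate
of a lovely pair (`IsRankOne.exists_isLovely`). A saturated elementary substructure of an
ultraproduct of these pairs (`exists_saturated_of_eventually`) is a lovely pair containing a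
conjugate of `b`, in which the formula "there is `x ∉ P` with `φ(b, x)`" has the wrong truth value.
The cardinality of this substructure has to be below `mu`; both it and the lovely pairs are
obtained as sets of values of a set of names, namely trees whose nodes are labelled by types, of
which there are at most `2 ^ ν` for types over `ν` parameters.

Conversely, suppose that the closure is definable and the generic quantifier is eliminable. Then a
`κ`-saturated model `(M, P)` of the common theory of all lovely pairs is lovely
(`IsRankOne.isLovely_of_isSaturated`). Over a set of fewer than `κ` parameters, a type outside the
closure of the parameters is realized in `P`, and also outside the closure of the parameters and
`P`, because finitely many formulas of the type, together with finitely many conditions of the form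
"`x ∈ P`" or "`x` is not in a set `χ(y, z, C)` contained in `cl(y, z)`, with `z` in `P`", are
satisfiable in every lovely pair as soon as the generic quantifier holds for the formulas, which is
a first-order condition. Types in the closure are handled by the first-order property that `P` is
closed.
-/

namespace LovelyPairs

open Set

/-! ### Formulas and their free variables -/

section Formulas

universe v w x

variable {L : FirstOrder.Language.{v, w}}

/-- The truth of a formula depends on finitely many variables only, the same ones in all
structures. -/
theorem realize_congr_of_eqOn_support {α : Type*} (φ : L.Formula α) :
    ∃ s : Finset α, ∀ (M : Type x) [L.Structure M] (v w : α → M), (∀ a ∈ s, v a = w a) →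
      (φ.Realize v ↔ φ.Realize w) := by
  classical
  refine ⟨φ.freeVarFinset, fun M _ v w h => ?_⟩
  have key : ∀ v : α → M, (BoundedFormula.restrictFreeVar φ id).Realize
      (fun a : φ.freeVarFinset => v a) default ↔ φ.Realize v := fun v =>
    BoundedFormula.realize_restrictFreeVar v (fun _ => rfl)
  rw [← key v, ← key w]
  have : (fun a : φ.freeVarFinset => v a) = fun a : φ.freeVarFinset => w a :=
    funext fun a => h a a.2
  rw [this]

/-- Only finitely many variables of a formula matter: those on the left can be replaced by a finite
tuple of them. -/
theorem exists_finite_left_variables {ι β : Type*} (φ : L.Formula (ι ⊕ β)) :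
    ∃ (m : ℕ) (e : Fin m → ι) (ψ : L.Formula (Fin m ⊕ β)),
      ∀ (M : Type x) [L.Structure M] (v : ι → M) (w : β → M),
        φ.Realize (Sum.elim v w) ↔ ψ.Realize (Sum.elim (v ∘ e) w) := by
  classical
  let s := φ.freeVarFinset.toLeft
  let e := s.equivFin
  let g : φ.freeVarFinset → Fin s.card ⊕ β := fun a => match a with
    | ⟨Sum.inl i, h⟩ => Sum.inl (e ⟨i, Finset.mem_toLeft.2 h⟩)
    | ⟨Sum.inr b, _⟩ => Sum.inr b
  refine ⟨s.card, fun i => (e.symm i : ι), BoundedFormula.restrictFreeVar φ g,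
    fun M _ v w => ?_⟩
  refine (BoundedFormula.realize_restrictFreeVar _ ?_).symm
  rintro ⟨i | b, h⟩ <;> simp [g]

/-- The universal closure of a formula. -/
theorem exists_sentence_iff_forall_realize {α : Type*} (φ : L.Formula α) :
    ∃ σ : L.Sentence, ∀ (M : Type x) [L.Structure M] [Nonempty M],
      M ⊨ σ ↔ ∀ v : α → M, φ.Realize v := by
  classical
  refine ⟨(Formula.exClosure φ.not).not, fun M _ _ => ?_⟩
  rw [Sentence.realize_not]
  have := @Formula.realize_exClosure L M _ α _ φ.not
  rw [this]
  push Not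
  constructor
  · intro h v
    exact not_not.1 (mt (BoundedFormula.realize_restrictFreeVar (φ := φ.not) (f := id)
      (v := fun a => v a) v fun _ => rfl).2 (h fun a => v a))
  · intro h v
    let v' : α → M := fun a => if ha : a ∈ φ.not.freeVarFinset then v ⟨a, ha⟩ else
      Classical.arbitrary M
    have hv' : ∀ a : φ.not.freeVarFinset, v (id a) = v' a := fun a => by
      simp only [v', dif_pos a.2, id]
    exact mt (BoundedFormula.realize_restrictFreeVar v' hv').1 (not_not.2 (h v'))

/-- The conjunction of a finite set of formulas. -/
noncomputable def conj {α : Type*} (s : Finset (L.Formula α)) : L.Formula α :=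
  Formula.iInf fun φ : s => (φ : L.Formula α)

theorem realize_conj {α : Type*} {s : Finset (L.Formula α)} {M : Type*} [L.Structure M]
    {v : α → M} : (conj s).Realize v ↔ ∀ φ ∈ s, φ.Realize v := by
  simp [conj, Formula.realize_iInf]

/-- The formula `∃ x, φ(y, x)`. -/
noncomputable def exLast {α : Type*} (φ : L.Formula (α ⊕ Fin 1)) : L.Formula α :=
  Formula.iExs (Fin 1) φ

theorem realize_exLast {α : Type*} {φ : L.Formula (α ⊕ Fin 1)} {M : Type*} [L.Structure M]
    {v : α → M} : (exLast φ).Realize v ↔ ∃ c : M, φ.Realize (Sum.elim v fun _ => c) := by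
  rw [exLast, Formula.realize_iExs]
  constructor
  · rintro ⟨w, hw⟩
    refine ⟨w 0, ?_⟩
    rwa [show (fun _ => w 0) = w from funext fun i => congrArg w (Subsingleton.elim 0 i)]
  · rintro ⟨c, hc⟩
    exact ⟨fun _ => c, hc⟩

end Formulas

/-! ### Saturated structures -/

section Saturation

variable {L : FirstOrder.Language.{u, u}} {M : Type u} [L.Structure M]

theorem IsSaturated.mono {lam lam' : Cardinal.{u}} (h : IsSaturated L M lam) (hl : lam' ≤ lam) :
    IsSaturated L M lam' := fun A hA => h A (hA.trans_le hl)

/-- Saturation for types whose parameters are given as a family. -/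
theorem IsSaturated.exists_realize {lam : Cardinal.{u}} (h : IsSaturated L M lam) {ι : Type u}
    (hι : #ι < lam) (v : ι → M) (p : Set (L.Formula (ι ⊕ Fin 1)))
    (hp : ∀ s : Finset (L.Formula (ι ⊕ Fin 1)), (s : Set _) ⊆ p →
      ∃ c : M, ∀ φ ∈ s, φ.Realize (Sum.elim v fun _ => c)) :
    ∃ c : M, ∀ φ ∈ p, φ.Realize (Sum.elim v fun _ => c) := by
  classical
  let r : ι ⊕ Fin 1 → range v ⊕ Fin 1 := Sum.map (rangeFactorization v) id
  have hr : ∀ (φ : L.Formula (ι ⊕ Fin 1)) (c : M),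
      (φ.relabel r).Realize (Sum.elim (↑) fun _ => c) ↔ φ.Realize (Sum.elim v fun _ => c) := by
    intro φ c
    rw [Formula.realize_relabel]
    have : (Sum.elim (↑) (fun _ => c) : range v ⊕ Fin 1 → M) ∘ r = Sum.elim v fun _ => c := by
      ext (i | i) <;> rfl
    rw [this]
  obtain ⟨c, hc⟩ := h (range v) (mk_range_le.trans_lt hι) (Formula.relabel r '' p) (by
    intro s hs
    obtain ⟨s', hs', rfl⟩ := Finset.subset_set_image_iff.1 hs
    obtain ⟨c, hc⟩ := hp s' hs'
    refine ⟨c, fun φ hφ => ?_⟩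
    obtain ⟨ψ, hψ, rfl⟩ := Finset.mem_image.1 hφ
    exact (hr ψ c).2 (hc ψ hψ))
  exact ⟨c, fun φ hφ => (hr φ c).1 (hc _ (mem_image_of_mem _ hφ))⟩

/-- One step of the construction below: a finitely satisfiable set `Γ` of formulas, with the
variables in `D` already evaluated, stays finitely satisfiable for some value of the variable
`i`. -/
theorem IsSaturated.exists_extend_assignment {lam : Cardinal.{u}} (h : IsSaturated L M lam)
    {K : Type u} (hK : #K < lam) (Γ : Set (L.Formula K)) (D : Set K) (i : K) (hi : i ∉ D)
    (v : K → M)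
    (hv : ∀ s : Finset (L.Formula K), (s : Set _) ⊆ Γ →
      ∃ w : K → M, (∀ k ∈ D, w k = v k) ∧ ∀ φ ∈ s, φ.Realize w) :
    ∃ c : M, ∀ s : Finset (L.Formula K), (s : Set _) ⊆ Γ →
      ∃ w : K → M, (∀ k ∈ D, w k = v k) ∧ w i = c ∧ ∀ φ ∈ s, φ.Realize w := by
  classical
  -- The projection of a finite part of `Γ` to the coordinate `i` is definable over `D`.
  have key : ∀ s : Finset (L.Formula K), ∃ θ : L.Formula (D ⊕ Fin 1), ∀ c : M,
      θ.Realize (Sum.elim (fun k : D => v k) fun _ => c) ↔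
        ∃ w : K → M, (∀ k ∈ D, w k = v k) ∧ w i = c ∧ ∀ φ ∈ s, φ.Realize w := by
    intro s
    obtain ⟨S, hS⟩ := realize_congr_of_eqOn_support.{u, u, u} (conj s)
    let r : K → (D ⊕ Fin 1) ⊕ ({k // k ∈ S} ⊕ Fin 1) := fun k =>
      if hk : k ∈ D then Sum.inl (Sum.inl ⟨k, hk⟩) else
        if k = i then Sum.inl (Sum.inr 0) else
          if hk : k ∈ S then Sum.inr (Sum.inl ⟨k, hk⟩) else Sum.inr (Sum.inr 0)
    refine ⟨Formula.iExs _ ((conj s).relabel r), fun c => ?_⟩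
    rw [Formula.realize_iExs]
    simp only [Formula.realize_relabel]
    constructor
    · rintro ⟨w, hw⟩
      refine ⟨_, fun k hk => ?_, ?_, realize_conj.1 hw⟩
      · simp [r, hk]
      · simp [r, hi]
    · rintro ⟨w, hw1, hw2, hw3⟩
      refine ⟨Sum.elim (fun k => w k) fun _ => c, ?_⟩
      refine (hS M _ w fun k hk => ?_).2 (realize_conj.2 hw3)
      by_cases hkD : k ∈ D
      · simp [r, hkD, hw1]
      · by_cases hki : k = i
        · subst hki
          simp [r, hkD, hw2]
        · simp [r, hkD, hki, hk]
  choose θ hθ using key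
  obtain ⟨c, hc⟩ := h.exists_realize (ι := D) ((mk_set_le D).trans_lt hK) (fun k => v k)
    (θ '' {s | (s : Set _) ⊆ Γ}) (by
      intro t ht
      obtain ⟨t', ht', rfl⟩ := Finset.subset_set_image_iff.1 ht
      obtain ⟨w, hw1, hw2⟩ := hv (t'.biUnion id) (by
        intro φ hφ
        obtain ⟨s, hs, hφs⟩ := Finset.mem_biUnion.1 hφ
        exact ht' hs hφs)
      refine ⟨w i, fun φ hφ => ?_⟩
      obtain ⟨s, hs, rfl⟩ := Finset.mem_image.1 hφ
      exact (hθ s _).2 ⟨w, hw1, rfl, fun φ hφ => hw2 φ (Finset.mem_biUnion.2 ⟨s, hs, hφ⟩)⟩)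
  exact ⟨c, fun s hs => (hθ s c).1 (hc _ (mem_image_of_mem _ hs))⟩

/-- A finitely satisfiable set of formulas in few variables is realized in a saturated structure:
the variables are evaluated one after the other, along a well-order. -/
theorem IsSaturated.exists_realize_all {lam : Cardinal.{u}} (h : IsSaturated L M lam)
    [Nonempty M] {K : Type u} (hK : #K < lam) (Γ : Set (L.Formula K))
    (hΓ : ∀ s : Finset (L.Formula K), (s : Set _) ⊆ Γ → ∃ w : K → M, ∀ φ ∈ s, φ.Realize w) :
    ∃ w : K → M, ∀ φ ∈ Γ, φ.Realize w := by
  classical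
  obtain ⟨lin, wf⟩ := exists_wellFoundedLT K
  let Good (D : Set K) (v : K → M) : Prop := ∀ s : Finset (L.Formula K), (s : Set _) ⊆ Γ →
    ∃ w : K → M, (∀ k ∈ D, w k = v k) ∧ ∀ φ ∈ s, φ.Realize w
  have congr : ∀ (D : Set K) (v v' : K → M), (∀ k ∈ D, v k = v' k) → Good D v → Good D v' := by
    intro D v v' hvv hg s hs
    obtain ⟨w, hw1, hw2⟩ := hg s hs
    exact ⟨w, fun k hk => (hw1 k hk).trans (hvv k hk), hw2⟩
  have step : ∀ (i : K) (v : K → M), ∃ c : M, Good (Iio i) v →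
      Good (Iic i) (Function.update v i c) := by
    intro i v
    by_cases hg : Good (Iio i) v
    · obtain ⟨c, hc⟩ := h.exists_extend_assignment hK Γ (Iio i) i (lt_irrefl i) v hg
      refine ⟨c, fun _ s hs => ?_⟩
      obtain ⟨w, hw1, hw2, hw3⟩ := hc s hs
      refine ⟨w, fun k hk => ?_, hw3⟩
      rcases (mem_Iic.1 hk).lt_or_eq with hlt | rfl
      · rw [Function.update_of_ne hlt.ne, hw1 k hlt]
      · simp [hw2]
    · exact ⟨Classical.arbitrary M, fun hg' => absurd hg' hg⟩
  choose F hF using step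
  let x₀ : M := Classical.arbitrary M
  let v : K → M := (wellFounded_lt (α := K)).fix fun i g =>
    F i fun j => if hj : j < i then g j hj else x₀
  have hv : ∀ i, v i = F i fun j => if j < i then v j else x₀ := by
    intro i
    have := (wellFounded_lt (α := K)).fix_eq (fun i (g : ∀ j, j < i → M) =>
      F i fun j => if hj : j < i then g j hj else x₀) i
    simpa only [dite_eq_ite] using this
  -- The limit step: a finite part of `Γ` has only finitely many variables, so the largest one that
  -- is already evaluated decides.
  have limit : ∀ D : Set K, (∀ i ∈ D, Iic i ⊆ D) → (∀ i ∈ D, Good (Iic i) v) → Good D v := by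
    intro D hD hg s hs
    obtain ⟨S, hS⟩ := realize_congr_of_eqOn_support.{u, u, u} (conj s)
    let S' := S.filter (· ∈ D)
    have fin : ∃ w : K → M, (∀ k ∈ S', w k = v k) ∧ ∀ φ ∈ s, φ.Realize w := by
      by_cases hne : S'.Nonempty
      · obtain ⟨w, hw1, hw2⟩ := hg (S'.max' hne)
          (Finset.mem_filter.1 (S'.max'_mem hne)).2 s hs
        exact ⟨w, fun k hk => hw1 k (S'.le_max' k hk), hw2⟩
      · obtain ⟨w, hw⟩ := hΓ s hs
        exact ⟨w, fun k hk => absurd ⟨k, hk⟩ hne, hw⟩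
    obtain ⟨w, hw1, hw2⟩ := fin
    refine ⟨fun k => if k ∈ D then v k else w k, fun k hk => by simp [hk], ?_⟩
    refine realize_conj.1 ((hS M _ w fun k hk => ?_).2 (realize_conj.2 hw2))
    by_cases hkD : k ∈ D
    · simp [hkD, hw1 k (Finset.mem_filter.2 ⟨hk, hkD⟩)]
    · simp [hkD]
  have main : ∀ i, Good (Iic i) v := by
    intro i
    induction i using (wellFounded_lt (α := K)).induction with
    | _ i ih =>
      have h1 : Good (Iio i) v := limit (Iio i) (fun j hj k hk => lt_of_le_of_lt hk hj) ih
      have h2 := hF i (fun j => if j < i then v j else x₀)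
        (congr _ _ _ (fun k hk => by simp [mem_Iio.1 hk]) h1)
      refine congr _ _ _ (fun k hk => ?_) h2
      rcases (mem_Iic.1 hk).lt_or_eq with hlt | rfl
      · rw [Function.update_of_ne hlt.ne, if_pos hlt]
      · rw [Function.update_self, ← hv k]
  have all : Good univ v := limit univ (fun _ _ => subset_univ _) (fun i _ => main i)
  refine ⟨v, fun φ hφ => ?_⟩
  obtain ⟨w, hw1, hw2⟩ := all {φ} (by simpa using hφ)
  have : w = v := funext fun k => hw1 k (mem_univ k)
  exact this ▸ hw2 φ (by simp)

end Saturation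

/-! ### Small sets and automorphisms of the monster model -/

section Small

variable {C : Type u} {mu : Cardinal.{u}} {A B : Set C}

theorem IsSmall.mono (hB : IsSmall mu B) (h : A ⊆ B) : IsSmall mu A :=
  (mk_le_mk_of_subset h).trans_lt hB

theorem IsSmall.union (hmu : ℵ₀ ≤ mu) (hA : IsSmall mu A) (hB : IsSmall mu B) :
    IsSmall mu (A ∪ B) :=
  (mk_union_le A B).trans_lt (add_lt_of_lt hmu hA hB)

theorem IsSmall.of_finite (hmu : ℵ₀ ≤ mu) (hA : A.Finite) : IsSmall mu A :=
  (lt_aleph0_iff_set_finite.2 hA).trans_le hmu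

theorem IsSmall.insert (hmu : ℵ₀ ≤ mu) (hA : IsSmall mu A) (c : C) : IsSmall mu (insert c A) := by
  rw [insert_eq]
  exact (IsSmall.of_finite hmu (finite_singleton c)).union hmu hA

theorem IsSmall.image {D : Type u} (hA : IsSmall mu A) (f : C → D) : IsSmall mu (f '' A) :=
  mk_image_le.trans_lt hA

theorem IsSmall.range {ι : Type u} (hι : #ι < mu) (f : ι → C) : IsSmall mu (range f) :=
  mk_range_le.trans_lt hι

end Small

section Automorphisms

variable {L : FirstOrder.Language.{u, u}} {C : Type u} [L.Structure C] {mu : Cardinal.{u}}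

theorem IsMonster.aleph0_le (hC : IsMonster L C mu) : ℵ₀ ≤ mu :=
  (le_max_left _ _).trans hC.theoryCard_lt.le

theorem IsMonster.exists_equiv_of_sameType (hC : IsMonster L C mu) {B : Set C}
    (hB : IsSmall mu B) {ι : Type u} (hι : #ι < mu) {a a' : ι → C} (h : SameType L B a a') :
    ∃ σ : C ≃[L] C, (∀ b ∈ B, σ b = b) ∧ ∀ i, σ (a i) = a' i := by
  obtain ⟨σ, hσ⟩ := hC.homogeneous (B ⊕ ι) (by
    rw [mk_sum, lift_id, lift_id]
    exact add_lt_of_lt hC.aleph0_le hB hι) _ _ h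
  exact ⟨σ, fun b hb => hσ (Sum.inl ⟨b, hb⟩), fun i => hσ (Sum.inr i)⟩

theorem IsMonster.exists_equiv_of_sameTypeFin (hC : IsMonster L C mu) {B : Set C}
    (hB : IsSmall mu B) {n : ℕ} {a a' : Fin n → C} (h : SameTypeFin L B a a') :
    ∃ σ : C ≃[L] C, (∀ b ∈ B, σ b = b) ∧ ∀ i, σ (a i) = a' i := by
  obtain ⟨σ, hσ, hσ'⟩ := hC.exists_equiv_of_sameType (ι := ULift (Fin n)) hB
    ((lt_aleph0_of_finite _).trans_le hC.aleph0_le) (a := fun i => a i.down)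
    (a' := fun i => a' i.down) (by
      intro φ
      have := h (φ.relabel (Sum.map id ULift.down))
      simp only [Formula.realize_relabel, Sum.elim_comp_map, Function.comp_id] at this
      exact this)
  exact ⟨σ, hσ, fun i => hσ' ⟨i⟩⟩

theorem realize_comp_equiv {ι : Type*} (σ : C ≃[L] C) (φ : L.Formula ι) (v : ι → C) :
    φ.Realize (fun i => σ (v i)) ↔ φ.Realize v :=
  StrongHomClass.realize_formula σ φ

theorem sameTypeFin_of_equiv {B : Set C} (σ : C ≃[L] C) (hσ : ∀ b ∈ B, σ b = b) {n : ℕ}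
    (a : Fin n → C) : SameTypeFin L B a fun i => σ (a i) := by
  intro φ
  rw [← realize_comp_equiv σ φ (Sum.elim (↑) a)]
  have : (fun i => σ (Sum.elim (↑) a i)) = (Sum.elim (↑) fun i => σ (a i) : B ⊕ Fin n → C) := by
    ext (b | i)
    · exact hσ b b.2
    · rfl
  rw [this]

theorem sameType₁_of_equiv {B : Set C} (σ : C ≃[L] C) (hσ : ∀ b ∈ B, σ b = b) (c : C) :
    SameType₁ L B c (σ c) :=
  sameTypeFin_of_equiv σ hσ _

theorem image_eq_of_fixed {B : Set C} (σ : C ≃[L] C) (hσ : ∀ b ∈ B, σ b = b) : σ '' B = B := by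
  rw [show σ '' B = id '' B from image_congr hσ, image_id]

theorem SameType₁.mono {A B : Set C} {c d : C} (h : SameType₁ L B c d) (hA : A ⊆ B) :
    SameType₁ L A c d := by
  intro φ
  have := h (φ.relabel (Sum.map (inclusion hA) id))
  simp only [Formula.realize_relabel, Sum.elim_comp_map, Function.comp_id] at this
  exact this

theorem SameType₁.trans {A : Set C} {c d e : C} (h : SameType₁ L A c d) (h' : SameType₁ L A d e) :
    SameType₁ L A c e := fun φ => (h φ).trans (h' φ)

theorem SameType₁.eq_of_mem {A : Set C} {c d : C} (h : SameType₁ L A c d) (hc : c ∈ A) :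
    d = c := by
  have := (h (Term.equal (Term.var (Sum.inr 0)) (Term.var (Sum.inl ⟨c, hc⟩)))).1 (by
    simp [Formula.realize_equal])
  simpa [Formula.realize_equal] using this

end Automorphisms

/-! ### Independence relations of rank 1 -/

section Closure

variable {L : FirstOrder.Language.{u, u}} {C : Type u} [L.Structure C] {mu : Cardinal.{u}}
  {ind : Set C → Set C → Set C → Prop}

/-- A superior independence relation of rank 1 on a monster model.  Superiority is expressed by the
local character of finite sets, and rank 1 by the dichotomy between closure and independence over
the empty set. -/
structure IsRankOne (L : FirstOrder.Language.{u, u}) {C : Type u} [L.Structure C]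
    (mu : Cardinal.{u}) (ind : Set C → Set C → Set C → Prop) : Prop where
  monster : IsMonster L C mu
  indep : IsIndependenceRelation L mu ind
  superior : ∀ A B : Set C, A.Finite → IsSmall mu B → ∃ B₀ ⊆ B, B₀.Finite ∧ ind A B₀ B
  dichotomy : ∀ (c : C) (B : Set C), IsSmall mu B → c ∉ mcl ind B → ind {c} ∅ B

/-- The infimum defining `κ₀` is attained, since the infimum of the empty set of cardinals is 0 and
not `ℵ₀`. -/
theorem superior_of_isSuperior (h : IsSuperior mu ind) (A B : Set C) (hA : A.Finite)
    (hB : IsSmall mu B) : ∃ B₀ ⊆ B, B₀.Finite ∧ ind A B₀ B := by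
  have hne : {k : Cardinal.{u} | k.IsRegular ∧ ∀ A B : Set C, A.Finite → IsSmall mu B →
      ∃ B₀ ⊆ B, #B₀ < k ∧ ind A B₀ B}.Nonempty := by
    by_contra hne
    rw [not_nonempty_iff_eq_empty] at hne
    have h' : kappaZero mu ind = ℵ₀ := h
    rw [kappaZero, hne, sInf_empty] at h'
    exact aleph0_ne_zero h'.symm
  have hmem := csInf_mem hne
  have h' : sInf _ = ℵ₀ := h
  rw [h'] at hmem
  obtain ⟨B₀, h1, h2, h3⟩ := hmem.2 A B hA hB
  exact ⟨B₀, h1, lt_aleph0_iff_set_finite.1 h2, h3⟩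

namespace IsRankOne

variable {A B D E S : Set C} {b c : C}

theorem le_mu (h : IsRankOne L mu ind) : ℵ₀ ≤ mu := h.monster.aleph0_le

theorem small_of_finite (h : IsRankOne L mu ind) (hA : A.Finite) : IsSmall mu A :=
  IsSmall.of_finite h.le_mu hA

theorem small_singleton (h : IsRankOne L mu ind) (c : C) : IsSmall mu {c} :=
  h.small_of_finite (finite_singleton c)

theorem ind_symm (h : IsRankOne L mu ind) (hA : IsSmall mu A) (hB : IsSmall mu B)
    (hD : IsSmall mu D) (hi : ind A B D) : ind D B A :=
  h.indep.symmetry A B D hA hB hD hi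

theorem ind_mono_left (h : IsRankOne L mu ind) (hA : IsSmall mu A) (hB : IsSmall mu B)
    (hD : IsSmall mu D) (hi : ind A B D) (hS : S ⊆ A) : ind S B D :=
  (h.indep.finiteCharacter S B D (hA.mono hS) hB hD).2 fun A₀ hA₀ hf =>
    (h.indep.finiteCharacter A B D hA hB hD).1 hi A₀ (hA₀.trans hS) hf

theorem ind_mono_right (h : IsRankOne L mu ind) (hA : IsSmall mu A) (hB : IsSmall mu B)
    (hD : IsSmall mu D) (hi : ind A B D) (hS : S ⊆ D) : ind A B S :=
  h.ind_symm (hD.mono hS) hB hA (h.ind_mono_left hD hB hA (h.ind_symm hA hB hD hi) hS)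

theorem ind_base_union (h : IsRankOne L mu ind) (hA : IsSmall mu A) (hB : IsSmall mu B)
    (hD : IsSmall mu D) (hi : ind A B D) : ind A B (B ∪ D) := by
  rw [union_comm]
  exact h.ind_symm (hD.union h.le_mu hB) hB hA
    (h.indep.normality D B A hD hB hA (h.ind_symm hA hB hD hi))

/-- Transitivity without inclusions between the sets. -/
theorem ind_chain (h : IsRankOne L mu ind) (hA : IsSmall mu A) (hB : IsSmall mu B)
    (hD : IsSmall mu D) (hE : IsSmall mu E) (h₁ : ind A B D) (h₂ : ind A (B ∪ D) E) :
    ind A B (D ∪ E) := by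
  have hBD := hB.union h.le_mu hD
  have hBDE := hBD.union h.le_mu hE
  refine h.ind_mono_right hA hB hBDE ((h.indep.transitivity A B (B ∪ D) (B ∪ D ∪ E) hA hBDE
    subset_union_left subset_union_left).2
    ⟨h.ind_base_union hA hB hD h₁, h.ind_base_union hA hBD hE h₂⟩) ?_
  rw [union_assoc]
  exact subset_union_right

theorem ind_base_mono (h : IsRankOne L mu ind) (hA : IsSmall mu A) (hE : IsSmall mu E)
    (hi : ind A B E) (hBD : B ⊆ D) (hDE : D ⊆ E) : ind A D E :=
  ((h.indep.transitivity A B D E hA hE hBD hDE).1 hi).2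

/-- The extension axiom, in terms of automorphisms. -/
theorem exists_equiv_ind (h : IsRankOne L mu ind) (hA : IsSmall mu A) (hB : IsSmall mu B)
    (hD : IsSmall mu D) : ∃ σ : C ≃[L] C, (∀ b ∈ B, σ b = b) ∧ ind (σ '' A) B D := by
  obtain ⟨A', ⟨f, rfl, hf⟩, hi⟩ := h.indep.extension A B D hA hB hD
  obtain ⟨σ, hσ, hσ'⟩ := h.monster.exists_equiv_of_sameType hB hA hf
  refine ⟨σ, hσ, ?_⟩
  convert hi
  ext x
  constructor
  · rintro ⟨a, ha, rfl⟩
    exact ⟨⟨a, ha⟩, (hσ' ⟨a, ha⟩).symm⟩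
  · rintro ⟨a, rfl⟩
    exact ⟨a, a.2, hσ' a⟩

theorem ind_image_iff (h : IsRankOne L mu ind) (hA : IsSmall mu A) (hB : IsSmall mu B)
    (hD : IsSmall mu D) (σ : C ≃[L] C) : ind (σ '' A) (σ '' B) (σ '' D) ↔ ind A B D := by
  refine ⟨fun hi => ?_, h.indep.invariance A B D hA hB hD σ⟩
  have := h.indep.invariance _ _ _ (hA.image σ) (hB.image σ) (hD.image σ) σ.symm hi
  simpa only [image_image, FirstOrder.Language.Equiv.symm_apply_apply, image_id'] using this

/-- The existence property, obtained from extension by applying an automorphism over `B`. -/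
theorem ind_self_base (h : IsRankOne L mu ind) (hA : IsSmall mu A) (hB : IsSmall mu B) :
    ind A B B := by
  obtain ⟨σ, hσ, hi⟩ := h.exists_equiv_ind hA hB hB
  rw [← h.ind_image_iff hA hB hB σ, image_eq_of_fixed σ hσ]
  exact hi

theorem subset_mcl (h : IsRankOne L mu ind) (hA : IsSmall mu A) : A ⊆ mcl ind A := fun c hc =>
  h.ind_mono_right (h.small_singleton c) hA hA (h.ind_self_base (h.small_singleton c) hA)
    (singleton_subset_iff.2 hc)

/-- An element of the closure of `A` is independent over `A` from every small set. -/
theorem ind_of_mem_mcl (h : IsRankOne L mu ind) (hA : IsSmall mu A) (hD : IsSmall mu D)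
    (hc : c ∈ mcl ind A) : ind {c} A D := by
  have hs := h.small_singleton c
  have hAc := hA.union h.le_mu hs
  have h1 : ind {c} (A ∪ {c}) D := h.ind_symm hD hAc hs
    (h.ind_mono_right hD hAc hAc (h.ind_self_base hD hAc) subset_union_right)
  exact h.ind_mono_right hs hA (hs.union h.le_mu hD) (h.ind_chain hs hA hs hD hc h1)
    subset_union_right

theorem mcl_mono (h : IsRankOne L mu ind) (hB : IsSmall mu B) (hAB : A ⊆ B) :
    mcl ind A ⊆ mcl ind B := fun c hc => by
  have hs := h.small_singleton c
  have hBc := hB.union h.le_mu hs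
  exact h.ind_mono_right hs hB hBc (h.ind_base_mono hs hBc
    (h.ind_of_mem_mcl (hB.mono hAB) hBc hc) hAB subset_union_left) subset_union_right

/-- The closure has finite character. -/
theorem exists_finite_of_mem_mcl (h : IsRankOne L mu ind) (hB : IsSmall mu B)
    (hc : c ∈ mcl ind B) : ∃ B₀ ⊆ B, B₀.Finite ∧ c ∈ mcl ind B₀ := by
  have hs := h.small_singleton c
  obtain ⟨B₀, hB₀, hf, hi⟩ := h.superior {c} B (finite_singleton c) hB
  refine ⟨B₀, hB₀, hf, ?_⟩
  have hB₀s := hB.mono hB₀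
  refine h.ind_mono_right hs hB₀s (hB.union h.le_mu hs)
    (h.ind_chain hs hB₀s hB hs hi ?_) subset_union_right
  rw [union_eq_self_of_subset_left hB₀]
  exact hc

theorem mem_mcl_of_mem_mcl_insert (h : IsRankOne L mu ind) (hA : IsSmall mu A)
    (hb : b ∈ mcl ind A) (hc : c ∈ mcl ind (insert b A)) : c ∈ mcl ind A := by
  have hsc := h.small_singleton c
  have hsb := h.small_singleton b
  have h1 : ind {c} A {b} := h.ind_symm hsb hA hsc (h.ind_of_mem_mcl hA hsc hb)
  rw [insert_eq, union_comm] at hc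
  exact h.ind_mono_right hsc hA (hsb.union h.le_mu hsc) (h.ind_chain hsc hA hsb hsc h1 hc)
    subset_union_right

/-- The closure is idempotent. -/
theorem mem_mcl_of_mem_mcl_union (h : IsRankOne L mu ind) (hA : IsSmall mu A) (hB : IsSmall mu B)
    (hBA : B ⊆ mcl ind A) (hc : c ∈ mcl ind (A ∪ B)) : c ∈ mcl ind A := by
  obtain ⟨S, hS, hf, hcS⟩ := h.exists_finite_of_mem_mcl (hA.union h.le_mu hB) hc
  have key : ∀ S : Set C, S.Finite → S ⊆ mcl ind A → ∀ c, c ∈ mcl ind (S ∪ A) → c ∈ mcl ind A := by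
    intro S hf
    induction S, hf using Set.Finite.induction_on with
    | empty => intro _ c hc; simpa using hc
    | @insert b S _ hf ih =>
      intro hS c hc
      rw [insert_subset_iff] at hS
      have hSA := (h.small_of_finite hf).union h.le_mu hA
      refine ih hS.2 c (h.mem_mcl_of_mem_mcl_insert hSA
        (h.mcl_mono hSA subset_union_right hS.1) ?_)
      rwa [insert_union] at hc
  refine key S hf (hS.trans (union_subset (h.subset_mcl hA) hBA)) c ?_
  exact h.mcl_mono ((h.small_of_finite hf).union h.le_mu hA) subset_union_left hcS

/-- In rank 1, an element outside the closure of `B` is independent from `B` over every subset. -/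
theorem ind_of_notMem_mcl (h : IsRankOne L mu ind) (hB : IsSmall mu B) (hAB : A ⊆ B)
    (hc : c ∉ mcl ind B) : ind {c} A B :=
  h.ind_base_mono (h.small_singleton c) hB (h.dichotomy c B hB hc) (empty_subset A) hAB

/-- An independent extension does not put an element into the closure. -/
theorem notMem_mcl_of_ind (h : IsRankOne L mu ind) (hA : IsSmall mu A) (hB : IsSmall mu B)
    (hAB : A ⊆ B) (hi : ind {c} A B) (hc : c ∉ mcl ind A) : c ∉ mcl ind B := fun hcB => hc (by
  have hs := h.small_singleton c
  refine h.ind_mono_right hs hA (hB.union h.le_mu hs) (h.ind_chain hs hA hB hs hi ?_)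
    subset_union_right
  rw [union_eq_self_of_subset_left hAB]
  exact hcB)

/-- The exchange property, a consequence of symmetry. -/
theorem exchange (h : IsRankOne L mu ind) (hA : IsSmall mu A)
    (hc : c ∈ mcl ind (insert b A)) (hcA : c ∉ mcl ind A) : b ∈ mcl ind (insert c A) := by
  by_contra hb
  have hsc := h.small_singleton c
  have hsb := h.small_singleton b
  have h1 : ind {b} A (insert c A) :=
    h.ind_of_notMem_mcl (hA.insert h.le_mu c) (subset_insert c A) hb
  have h2 : ind {c} A {b} := h.ind_symm hsb hA hsc
    (h.ind_mono_right hsb hA (hA.insert h.le_mu c) h1 (singleton_subset_iff.2 (mem_insert c A)))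
  have h3 := h.ind_base_union hsc hA hsb h2
  refine h.notMem_mcl_of_ind hA (hA.union h.le_mu hsb) subset_union_left h3 hcA ?_
  rwa [union_comm, ← insert_eq]

theorem mem_mcl_image_iff (h : IsRankOne L mu ind) (hA : IsSmall mu A) (σ : C ≃[L] C) :
    σ c ∈ mcl ind (σ '' A) ↔ c ∈ mcl ind A := by
  have hs := h.small_singleton c
  have := h.ind_image_iff hs hA hs σ
  rwa [image_singleton] at this

theorem mem_mcl_iff_of_fixed (h : IsRankOne L mu ind) (hA : IsSmall mu A) (σ : C ≃[L] C)
    (hσ : ∀ a ∈ A, σ a = a) : σ c ∈ mcl ind A ↔ c ∈ mcl ind A := by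
  have := h.mem_mcl_image_iff (c := c) hA σ
  rwa [image_eq_of_fixed σ hσ] at this

theorem mem_mcl_iff_of_sameType₁ (h : IsRankOne L mu ind) (hA : IsSmall mu A) {d : C}
    (hcd : SameType₁ L A c d) : c ∈ mcl ind A ↔ d ∈ mcl ind A := by
  obtain ⟨σ, hσ, hσ'⟩ := h.monster.exists_equiv_of_sameTypeFin hA hcd
  rw [← hσ' 0, h.mem_mcl_iff_of_fixed hA σ hσ]

/-- An element outside the closure of `A` has a conjugate over `A` outside the closure of any given
small set. -/
theorem exists_equiv_notMem_mcl (h : IsRankOne L mu ind) (hD : IsSmall mu D) (hA : IsSmall mu A)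
    (hc : c ∉ mcl ind A) : ∃ σ : C ≃[L] C, (∀ a ∈ A, σ a = a) ∧ σ c ∉ mcl ind (A ∪ D) := by
  have hs := h.small_singleton c
  obtain ⟨σ, hσ, hi⟩ := h.exists_equiv_ind hs hA (hA.union h.le_mu hD)
  rw [image_singleton] at hi
  exact ⟨σ, hσ, h.notMem_mcl_of_ind hA (hA.union h.le_mu hD) subset_union_left hi
    (mt (h.mem_mcl_iff_of_fixed hA σ hσ).1 hc)⟩

/-- An independence for one element extends to a set once it holds over that element. -/
theorem ind_insert (h : IsRankOne L mu ind) (hA : IsSmall mu A) (hB : IsSmall mu B)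
    (hS : IsSmall mu S) (hc : ind {c} A B) (hi : ind S (insert c A) B) :
    ind (insert c S) A B := by
  have hs := h.small_singleton c
  rw [insert_eq]
  rw [insert_eq, union_comm] at hi
  exact h.ind_symm hB hA (hs.union h.le_mu hS) (h.ind_chain hB hA hs hS (h.ind_symm hs hA hB hc)
    (h.ind_symm hS (hA.union h.le_mu hs) hB hi))

end IsRankOne

end Closure

/-! ### The rank of a finite tuple -/

section Rank

variable {L : FirstOrder.Language.{u, u}} {C : Type u} [L.Structure C] {mu : Cardinal.{u}}
  {ind : Set C → Set C → Set C → Prop}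

/-- The sequence `l` is closure-independent over `A`: no term lies in the closure of `A` and the
preceding terms. -/
def IndepSeq (ind : Set C → Set C → Set C → Prop) : Set C → List C → Prop
  | _, [] => True
  | A, c :: l => c ∉ mcl ind A ∧ IndepSeq ind (insert c A) l

namespace IsRankOne

variable {A B : Set C} {l : List C} {c : C}

theorem indepSeq_mono (h : IsRankOne L mu ind) (hB : IsSmall mu B) (hAB : A ⊆ B)
    (hl : IndepSeq ind B l) : IndepSeq ind A l := by
  induction l generalizing A B with
  | nil => trivial
  | cons c l ih =>
    exact ⟨mt (fun hc => h.mcl_mono hB hAB hc) hl.1,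
      ih (hB.insert h.le_mu c) (insert_subset_insert hAB) hl.2⟩

theorem indepSeq_append_singleton : IndepSeq ind A (l ++ [c]) ↔
    IndepSeq ind A l ∧ c ∉ mcl ind (A ∪ {x | x ∈ l}) := by
  induction l generalizing A with
  | nil => simp [IndepSeq]
  | cons d l ih =>
    have : insert d A ∪ {x | x ∈ l} = A ∪ {x | x ∈ d :: l} := by
      ext x
      simp only [mem_union, mem_insert_iff, mem_ofPred_eq, List.mem_cons]
      tauto
    rw [List.cons_append, IndepSeq, IndepSeq, ih, this, and_assoc]

theorem small_list (h : IsRankOne L mu ind) (l : List C) : IsSmall mu {x | x ∈ l} :=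
  h.small_of_finite l.finite_toSet

theorem indepSeq_map_iff (h : IsRankOne L mu ind) (hA : IsSmall mu A) (σ : C ≃[L] C) :
    IndepSeq ind (σ '' A) (l.map σ) ↔ IndepSeq ind A l := by
  induction l generalizing A with
  | nil => simp [IndepSeq]
  | cons d l ih =>
    rw [List.map_cons, IndepSeq, IndepSeq, h.mem_mcl_image_iff hA σ, ← image_insert_eq,
      ih (hA.insert h.le_mu d)]

theorem indepSeq_nodup (h : IsRankOne L mu ind) (hA : IsSmall mu A) (hl : IndepSeq ind A l) :
    (∀ x ∈ l, x ∉ A) ∧ l.Nodup := by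
  induction l generalizing A with
  | nil => simp
  | cons d l ih =>
    obtain ⟨h1, h2⟩ := ih (hA.insert h.le_mu d) hl.2
    refine ⟨fun x hx hxA => ?_, List.nodup_cons.2 ⟨fun hd => h1 d hd (mem_insert d A), h2⟩⟩
    rcases List.mem_cons.1 hx with rfl | hx
    · exact hl.1 (h.subset_mcl hA hxA)
    · exact h1 x hx (mem_insert_of_mem d hxA)

theorem ind_empty (h : IsRankOne L mu ind) (hA : IsSmall mu A) (hB : IsSmall mu B) :
    ind ∅ A B :=
  h.ind_mono_left hA hA hB (h.ind_symm hB hA hA (h.ind_self_base hB hA)) (empty_subset A)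

theorem ind_of_indepSeq (h : IsRankOne L mu ind) (hB : IsSmall mu B) (hAB : A ⊆ B)
    (hl : IndepSeq ind B l) : ind {x | x ∈ l} A B := by
  induction l generalizing A B with
  | nil => simpa using h.ind_empty (hB.mono hAB) hB
  | cons c l ih =>
    have hA := hB.mono hAB
    have hset : {x | x ∈ c :: l} = insert c {x | x ∈ l} := by ext; simp
    rw [hset]
    exact h.ind_insert hA hB (h.small_list l) (h.ind_of_notMem_mcl hB hAB hl.1)
      (h.ind_mono_right (h.small_list l) (hA.insert h.le_mu c) (hB.insert h.le_mu c)
        (ih (hB.insert h.le_mu c) (insert_subset_insert hAB) hl.2) (subset_insert c B))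

theorem ind_of_finite_subset_mcl (h : IsRankOne L mu ind) (hA : IsSmall mu A) (hB : IsSmall mu B)
    {S : Set C} (hS : S.Finite) (hSA : S ⊆ mcl ind A) : ind S A B := by
  induction S, hS using Set.Finite.induction_on generalizing A with
  | empty => exact h.ind_empty hA hB
  | @insert c S _ hf ih =>
    rw [insert_subset_iff] at hSA
    exact h.ind_insert hA hB (h.small_of_finite hf) (h.ind_of_mem_mcl hA hB hSA.1)
      (ih (hA.insert h.le_mu c)
        (hSA.2.trans (h.mcl_mono (hA.insert h.le_mu c) (subset_insert c A))))

/-- A forking extension loses dimension: a sequence in a finite tuple that is closure-independent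
over the larger base can be prolonged over the smaller one. -/
theorem exists_indepSeq_append (h : IsRankOne L mu ind) (hB : IsSmall mu B) (hAB : A ⊆ B)
    {S : Set C} (hS : S.Finite) (hf : ¬ ind S A B) (hl : IndepSeq ind B l) :
    ∃ c ∈ S, IndepSeq ind A (l ++ [c]) := by
  by_contra! hcon
  have hA := hB.mono hAB
  have hAl := hA.union h.le_mu (h.small_list l)
  have hSs := h.small_of_finite hS
  have hSA : S ⊆ mcl ind (A ∪ {x | x ∈ l}) := fun c hc => by
    by_contra hcl
    exact hcon c hc (indepSeq_append_singleton.2 ⟨h.indepSeq_mono hB hAB hl, hcl⟩)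
  refine hf (h.ind_symm hB hA hSs (h.ind_mono_right hB hA ((h.small_list l).union h.le_mu hSs)
    (h.ind_chain hB hA (h.small_list l) hSs ?_ ?_) subset_union_right))
  · exact h.ind_symm (h.small_list l) hA hB (h.ind_of_indepSeq hB hAB hl)
  · exact h.ind_symm hSs hAl hB (h.ind_of_finite_subset_mcl hAl hB hS hSA)

end IsRankOne

theorem RankGE.mono {α β : Ordinal.{u}} {n : ℕ} {a : Fin n → C} {A : Set C}
    (h : RankGE L mu ind α a A) (hβ : β ≤ α) : RankGE L mu ind β a A := by
  rw [RankGE] at h ⊢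
  exact fun γ hγ => h γ (hγ.trans_le hβ)

namespace IsRankOne

variable {A B : Set C}

/-- The rank of a finite tuple is its dimension with respect to the closure. -/
theorem rankGE_natCast_iff (h : IsRankOne L mu ind) (k : ℕ) {n : ℕ} (a : Fin n → C)
    (hA : IsSmall mu A) : RankGE L mu ind k a A ↔
      ∃ l : List C, l.length = k ∧ (∀ x ∈ l, x ∈ range a) ∧ IndepSeq ind A l := by
  induction k generalizing a A with
  | zero =>
    refine ⟨fun _ => ⟨[], rfl, by simp, trivial⟩, fun _ => ?_⟩
    rw [RankGE]
    intro β hβ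
    simp at hβ
  | succ k ih =>
    constructor
    · intro hr
      rw [RankGE] at hr
      obtain ⟨B, a', hAB, hB, haa', hf, hr⟩ := hr k (by exact_mod_cast Nat.lt_succ_self k)
      obtain ⟨l, rfl, hla, hl⟩ := (ih a' hB).1 hr
      obtain ⟨c, hc, hlc⟩ := h.exists_indepSeq_append hB hAB (finite_range a') hf hl
      obtain ⟨σ, hσ, hσ'⟩ := h.monster.exists_equiv_of_sameTypeFin hA haa'
      have hσs : ∀ x ∈ range a', σ.symm x ∈ range a := by
        rintro _ ⟨i, rfl⟩
        exact ⟨i, by rw [← hσ' i, FirstOrder.Language.Equiv.symm_apply_apply]⟩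
      refine ⟨(l ++ [c]).map σ.symm, by simp, ?_, ?_⟩
      · intro x hx
        obtain ⟨y, hy, rfl⟩ := List.mem_map.1 hx
        refine hσs y ?_
        rcases List.mem_append.1 hy with hy | hy
        · exact hla y hy
        · rwa [List.mem_singleton.1 hy]
      · have hσA : σ.symm '' A = A := image_eq_of_fixed σ.symm fun b hb => by
          conv_lhs => rw [← hσ b hb, FirstOrder.Language.Equiv.symm_apply_apply]
        rw [← hσA, h.indepSeq_map_iff hA]
        exact hlc
    · rintro ⟨l, hlk, hla, hl⟩
      obtain _ | ⟨c, l⟩ := l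
      · simp at hlk
      rw [RankGE]
      intro β hβ
      have hβk : β ≤ k := by
        rw [Nat.cast_succ] at hβ
        exact Order.lt_add_one_iff.1 hβ
      have hcA := hA.insert h.le_mu c
      have hca : c ∈ range a := hla c List.mem_cons_self
      refine ⟨insert c A, a, subset_insert c A, hcA, fun φ => Iff.rfl, fun hi => hl.1 ?_,
        RankGE.mono ((ih a hcA).2 ⟨l, by simpa using hlk,
          fun x hx => hla x (List.mem_cons_of_mem c hx), hl.2⟩) hβk⟩
      have hra := h.small_of_finite (finite_range a)
      exact h.ind_mono_left hra hA (h.small_singleton c) (h.ind_mono_right hra hA hcA hi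
        (singleton_subset_iff.2 (mem_insert c A))) (singleton_subset_iff.2 hca)

theorem exists_uRank_eq (h : IsRankOne L mu ind) {n : ℕ} (a : Fin n → C) (hA : IsSmall mu A) :
    ∃ k : ℕ, uRank L mu ind a A = (k : WithTop Ordinal.{u}) ∧
      ∀ j : ℕ, RankGE L mu ind j a A ↔ j ≤ k := by
  classical
  have hbound : ∀ j : ℕ, RankGE L mu ind j a A → j ≤ n := by
    intro j hj
    obtain ⟨l, rfl, hla, hl⟩ := (h.rankGE_natCast_iff j a hA).1 hj
    have := ((h.indepSeq_nodup hA hl).2.subperm (l₂ := List.ofFn a)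
      fun x hx => List.mem_ofFn.2 (hla x hx)).length_le
    simpa using this
  let k := Nat.findGreatest (fun j => RankGE L mu ind j a A) n
  have hk : RankGE L mu ind k a A := Nat.findGreatest_spec (P := fun j : ℕ =>
    RankGE L mu ind j a A) (Nat.zero_le n) (by
      rw [RankGE]; intro β hβ; simp at hβ)
  have hk' : ∀ j : ℕ, RankGE L mu ind j a A ↔ j ≤ k := fun j =>
    ⟨fun hj => Nat.le_findGreatest (hbound j hj) hj, fun hj => hk.mono (by exact_mod_cast hj)⟩
  refine ⟨k, ?_, hk'⟩
  have : IsGreatest ((fun α : Ordinal.{u} => (α : WithTop Ordinal.{u})) ''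
      {α | RankGE L mu ind α a A}) (((k : Ordinal.{u})) : WithTop Ordinal.{u}) := by
    refine ⟨mem_image_of_mem _ hk, ?_⟩
    rintro _ ⟨α, hα, rfl⟩
    refine WithTop.coe_le_coe.2 (le_of_not_gt fun hlt => ?_)
    have h1 : RankGE L mu ind ((k + 1 : ℕ) : Ordinal.{u}) a A := hα.mono (by
      rw [Nat.cast_succ]
      exact Order.add_one_le_of_lt hlt)
    exact absurd ((hk' _).1 h1) (by omega)
  rw [uRank, this.csSup_eq]
  rfl

theorem uRankSet_eq_natCast_iff (h : IsRankOne L mu ind) {n : ℕ} (X : Set (Fin n → C))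
    (hA : IsSmall mu A) (k : ℕ) :
    uRankSet L mu ind X A = (k : WithBot (WithTop Ordinal.{u})) ↔
      (∃ a ∈ X, RankGE L mu ind k a A) ∧ ¬ ∃ a ∈ X, RankGE L mu ind (k + 1 : ℕ) a A := by
  have hcast : ∀ j : ℕ, (((j : WithTop Ordinal.{u})) : WithBot (WithTop Ordinal.{u})) =
      (j : WithBot (WithTop Ordinal.{u})) := fun j => rfl
  choose r hr hr' using fun a : Fin n → C => h.exists_uRank_eq a hA
  have hle : ∀ i j : ℕ, (i : WithBot (WithTop Ordinal.{u})) ≤ j ↔ i ≤ j := by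
    intro i j
    rw [← hcast, ← hcast, WithBot.coe_le_coe]
    exact_mod_cast Iff.rfl
  have hU : uRankSet L mu ind X A = ⨆ a ∈ X, ((r a : ℕ) : WithBot (WithTop Ordinal.{u})) := by
    rw [uRankSet]
    simp only [hr, hcast]
  rw [hU]
  simp only [hr']
  constructor
  · intro heq
    have hall : ∀ a ∈ X, r a ≤ k := fun a ha => (hle _ _).1 (heq ▸
      le_iSup₂ (f := fun a (_ : a ∈ X) =>
      ((r a : ℕ) : WithBot (WithTop Ordinal.{u}))) a ha)
    refine ⟨?_, fun ⟨a, ha, hka⟩ => absurd (hall a ha) (by omega)⟩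
    by_contra! hcon
    obtain _ | j := k
    · have hX : X = ∅ := by
        ext a
        simp only [mem_empty_iff_false, iff_false]
        exact fun ha => absurd (hcon a ha) (by omega)
      subst hX
      simp only [mem_empty_iff_false, iSup_false, iSup_bot] at heq
      exact WithBot.bot_ne_coe heq
    · have : (⨆ a ∈ X, ((r a : ℕ) : WithBot (WithTop Ordinal.{u}))) ≤ (j : ℕ) :=
        iSup₂_le fun a ha => (hle _ _).2 (by have := hcon a ha; omega)
      rw [heq, hle] at this
      omega
  · rintro ⟨⟨a, ha, hka⟩, hn⟩
    push Not at hn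
    refine le_antisymm (iSup₂_le fun b hb => (hle _ _).2 (by have := hn b hb; omega)) ?_
    exact ((hle _ _).2 hka).trans (le_iSup₂ (f := fun a (_ : a ∈ X) =>
      ((r a : ℕ) : WithBot (WithTop Ordinal.{u}))) a ha)

end IsRankOne

/-- The rank being 1, an element `c` outside the closure of a small set `B` is independent from it:
otherwise the types of `c` over `∅`, `B` and `B ∪ {c}` form a forking chain, which makes the rank of
`c` at least 2. -/
theorem dichotomy_of_uRankSet (hC : IsMonster L C mu) (hind : IsIndependenceRelation L mu ind)
    (hrank : uRankSet L mu ind (Set.univ : Set (Fin 1 → C)) ∅ = 1) (c : C) (B : Set C)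
    (hB : IsSmall mu B) (hc : c ∉ mcl ind B) : ind {c} ∅ B := by
  by_contra hi
  have h2 : RankGE L mu ind 2 (fun _ : Fin 1 => c) ∅ := by
    rw [RankGE]
    intro β hβ
    refine ⟨B, fun _ => c, empty_subset B, hB, fun φ => Iff.rfl, by simpa using hi, ?_⟩
    rw [RankGE]
    intro γ hγ
    refine ⟨insert c B, fun _ => c, subset_insert c B, hB.insert hC.aleph0_le c,
      fun φ => Iff.rfl, fun hi' => hc ?_, ?_⟩
    · rw [range_const] at hi'
      have hcB := hB.insert hC.aleph0_le c
      have hs := IsSmall.of_finite hC.aleph0_le (finite_singleton c)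
      exact hind.symmetry _ _ _ hs hB hs ((hind.finiteCharacter _ _ _ hcB hB hs).1
        (hind.symmetry _ _ _ hs hB hcB hi') {c} (singleton_subset_iff.2 (mem_insert c B))
        (finite_singleton c))
    · have hγ0 : γ = 0 := by
        rw [← one_add_one_eq_two] at hβ
        exact Order.lt_one_iff.1 (hγ.trans_le (Order.lt_add_one_iff.1 hβ))
      rw [hγ0, RankGE]
      intro δ hδ
      simp at hδ
  have hle : ((2 : Ordinal.{u}) : WithTop Ordinal.{u}) ≤ uRank L mu ind (fun _ : Fin 1 => c) ∅ :=
    le_sSup (mem_image_of_mem _ h2)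
  have hle' : ((uRank L mu ind (fun _ : Fin 1 => c) ∅ : WithTop Ordinal.{u}) :
      WithBot (WithTop Ordinal.{u})) ≤ 1 := by
    rw [← hrank]
    exact le_iSup₂ (f := fun (a : Fin 1 → C) (_ : a ∈ Set.univ) =>
      (uRank L mu ind a ∅ : WithBot (WithTop Ordinal.{u}))) (fun _ => c) (Set.mem_univ _)
  have h21 : ((2 : Ordinal.{u}) : WithTop Ordinal.{u}) ≤
      ((1 : Ordinal.{u}) : WithTop Ordinal.{u}) :=
    hle.trans (WithBot.coe_le_coe.1 hle')
  have := WithTop.coe_le_coe.1 h21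
  exact absurd this (by norm_num)

end Rank

/-! ### Definability of the rank and the generic quantifier -/

section Generic

variable {L : FirstOrder.Language.{u, u}} {C : Type u} [L.Structure C] {mu : Cardinal.{u}}
  {ind : Set C → Set C → Set C → Prop}

/-- The quantifier "there is an element outside the closure of the parameters" is eliminable. -/
def GenericDefinable (L : FirstOrder.Language.{u, u}) {C : Type u} [L.Structure C]
    (ind : Set C → Set C → Set C → Prop) : Prop :=
  ∀ (m : ℕ) (φ : L.Formula (Fin m ⊕ Fin 1)), ∃ ψ : L.Formula (Fin m), ∀ b : Fin m → C,
    ψ.Realize b ↔ ∃ c, c ∉ mcl ind (range b) ∧ φ.Realize (Sum.elim b fun _ => c)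

theorem range_elim_const {ι : Type*} (b : ι → C) (c : C) :
    range (Sum.elim b fun _ : Fin 1 => c) = insert c (range b) := by
  rw [Sum.elim_range, range_const, union_comm, ← insert_eq]

namespace IsRankOne

/-- A definable set has a point outside the closure of its parameters if and only if it has one
outside the closure of any given small set containing the parameters. -/
theorem exists_notMem_mcl_iff (h : IsRankOne L mu ind) {ι : Type*} (φ : L.Formula (ι ⊕ Fin 1))
    (b : ι → C) {D : Set C} (hD : IsSmall mu D) (hb : range b ⊆ D) :
    (∃ c, c ∉ mcl ind (range b) ∧ φ.Realize (Sum.elim b fun _ => c)) ↔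
      ∃ c, c ∉ mcl ind D ∧ φ.Realize (Sum.elim b fun _ => c) := by
  constructor
  · rintro ⟨c, hc, hφ⟩
    obtain ⟨σ, hσ, hσc⟩ := h.exists_equiv_notMem_mcl hD (hD.mono hb) hc
    rw [union_eq_self_of_subset_left hb] at hσc
    refine ⟨σ c, hσc, ?_⟩
    rw [← realize_comp_equiv σ] at hφ
    convert hφ using 1
    ext (i | i)
    · exact (hσ (b i) (mem_range_self i)).symm
    · rfl
  · rintro ⟨c, hc, hφ⟩
    exact ⟨c, mt (fun hcb => h.mcl_mono hD hb hcb) hc, hφ⟩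

/-- The generic quantifier is also eliminable for formulas with any small set of parameters, of
which only finitely many matter. -/
theorem exists_formula_generic (h : IsRankOne L mu ind) (hG : GenericDefinable L ind) {ι : Type u}
    (hι : #ι < mu) (φ : L.Formula (ι ⊕ Fin 1)) : ∃ ψ : L.Formula ι, ∀ b : ι → C,
      ψ.Realize b ↔ ∃ c, c ∉ mcl ind (range b) ∧ φ.Realize (Sum.elim b fun _ => c) := by
  obtain ⟨m, e, φ', hφ'⟩ := exists_finite_left_variables φ
  obtain ⟨ψ, hψ⟩ := hG m φ'
  refine ⟨ψ.relabel e, fun b => ?_⟩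
  rw [Formula.realize_relabel, hψ,
    h.exists_notMem_mcl_iff φ' (b ∘ e) (IsSmall.range hι b) (range_comp_subset_range e b)]
  have hφc := fun c : C => hφ' C b fun _ => c
  simp only [hφc]

/-- The generic quantifier, applied once for each term, expresses that the terms of a tuple with the
positions `s` are closure-independent. -/
theorem exists_formula_indepSeq (h : IsRankOne L mu ind) (hG : GenericDefinable L ind) {n : ℕ}
    (s : List (Fin n)) {ι : Type u} (hι : #ι < mu) (φ : L.Formula (Fin n ⊕ ι)) :
    ∃ ψ : L.Formula ι, ∀ b : ι → C, ψ.Realize b ↔ ∃ a : Fin n → C,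
      φ.Realize (Sum.elim a b) ∧ IndepSeq ind (range b) (s.map a) := by
  induction s generalizing ι with
  | nil =>
    refine ⟨Formula.iExs (Fin n) (φ.relabel Sum.swap), fun b => ?_⟩
    have : ∀ a : Fin n → C, Sum.elim b a ∘ Sum.swap = Sum.elim a b := fun a => by
      ext (i | i) <;> rfl
    simp [Formula.realize_iExs, Formula.realize_relabel, this, IndepSeq]
  | cons i s ih =>
    let φ' : L.Formula (Fin n ⊕ (ι ⊕ Fin 1)) := φ.relabel (Sum.map id Sum.inl) ⊓
      Term.equal (Term.var (Sum.inl i)) (Term.var (Sum.inr (Sum.inr 0)))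
    have hφ' : ∀ (a : Fin n → C) (b : ι → C) (c : C),
        φ'.Realize (Sum.elim a (Sum.elim b fun _ => c)) ↔
          φ.Realize (Sum.elim a b) ∧ a i = c := by
      intro a b c
      simp [φ', Formula.realize_relabel, Formula.realize_equal, Sum.elim_comp_map]
    obtain ⟨θ, hθ⟩ := ih (ι := ι ⊕ Fin 1) (by
      simpa using add_lt_of_lt h.le_mu hι
        (one_lt_aleph0.trans_le h.le_mu)) φ'
    obtain ⟨ψ, hψ⟩ := h.exists_formula_generic hG hι θ
    refine ⟨ψ, fun b => ?_⟩
    rw [hψ]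
    simp only [hθ, hφ', range_elim_const, List.map_cons, IndepSeq]
    constructor
    · rintro ⟨_, hc, a, ⟨ha, rfl⟩, hs⟩
      exact ⟨a, ha, hc, hs⟩
    · rintro ⟨a, ha, hc, hs⟩
      exact ⟨a i, hc, a, ⟨ha, rfl⟩, hs⟩

theorem exists_formula_rankGE (h : IsRankOne L mu ind) (hG : GenericDefinable L ind) {n : ℕ}
    (k : ℕ) {ι : Type u} (hι : #ι < mu) (φ : L.Formula (Fin n ⊕ ι)) :
    ∃ ψ : L.Formula ι, ∀ b : ι → C, ψ.Realize b ↔ ∃ a : Fin n → C,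
      φ.Realize (Sum.elim a b) ∧ RankGE L mu ind k a (range b) := by
  choose ψ hψ using fun s : Fin k → Fin n => h.exists_formula_indepSeq hG (List.ofFn s) hι φ
  refine ⟨Formula.iSup ψ, fun b => ?_⟩
  simp only [Formula.realize_iSup, hψ, h.rankGE_natCast_iff k _ (IsSmall.range hι b)]
  constructor
  · rintro ⟨s, a, ha, hs⟩
    refine ⟨a, ha, _, by simp, fun x hx => ?_, hs⟩
    obtain ⟨i, -, rfl⟩ := List.mem_map.1 hx
    exact mem_range_self i
  · rintro ⟨a, ha, l, rfl, hla, hl⟩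
    choose s hs using fun i : Fin l.length => hla (l.get i) (List.get_mem l i)
    refine ⟨s, a, ha, ?_⟩
    have : (List.ofFn s).map a = l := by
      rw [List.map_ofFn]
      conv_rhs => rw [← List.ofFn_get l]
      exact congrArg List.ofFn (funext hs)
    rwa [this]

/-- The rank of a definable set is the largest number of closure-independent coordinates of a point
of it. -/
theorem uDefinable_of_genericDefinable (h : IsRankOne L mu ind) (hG : GenericDefinable L ind) :
    UDefinable L mu ind := by
  intro A hA n m k φ
  obtain ⟨φ', hφ'⟩ := definable_iff_exists_formula_sum.1
    (⟨φ, rfl⟩ : A.Definable L (Set.ofPred φ.Realize))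
  let r : A ⊕ (Fin n ⊕ Fin m) → Fin n ⊕ (A ⊕ Fin m) :=
    Sum.elim (fun x => Sum.inr (Sum.inl x)) (Sum.map id Sum.inr)
  have hr : ∀ (a : Fin n → C) (b : Fin m → C), (φ'.relabel r).Realize
      (Sum.elim a (Sum.elim (fun x : A => (x : C)) b)) ↔ φ.Realize (Sum.elim a b) := by
    intro a b
    rw [Formula.realize_relabel]
    have h1 : Sum.elim a (Sum.elim (fun x : A => (x : C)) b) ∘ r =
        Sum.elim (fun x : A => (x : C)) (Sum.elim a b) := by
      ext (x | x | x) <;> rfl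
    rw [h1]
    exact (Set.ext_iff.1 hφ' (Sum.elim a b)).symm
  have hι : #(A ⊕ Fin m) < mu := by
    simpa using add_lt_of_lt h.le_mu hA
      ((natCast_lt_aleph0 (n := m)).trans_le h.le_mu)
  obtain ⟨ψ, hψ⟩ := h.exists_formula_rankGE hG k hι (φ'.relabel r)
  obtain ⟨ψ', hψ'⟩ := h.exists_formula_rankGE hG (k + 1) hι (φ'.relabel r)
  refine definable_iff_exists_formula_sum.2 ⟨ψ ⊓ ψ'.not, ?_⟩
  ext b
  have hrange : range (Sum.elim (fun x : A => (x : C)) b) = A ∪ range b := by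
    rw [Sum.elim_range, Subtype.range_coe]
  have hs : IsSmall mu (A ∪ range b) := hrange ▸ IsSmall.range hι _
  rw [mem_ofPred_eq, h.uRankSet_eq_natCast_iff _ hs, mem_ofPred_eq, Formula.realize_inf,
    Formula.realize_not, hψ, hψ', hrange]
  simp only [hr]
  rfl

/-- The rank of an element being at most 1, the set `φ(b, C)` has rank 1 if and only if it has a
point outside the closure of `b`. -/
theorem genericDefinable_of_uDefinable (h : IsRankOne L mu ind) (hU : UDefinable L mu ind) :
    GenericDefinable L ind := by
  intro m φ
  have hempty : IsSmall mu (∅ : Set C) := h.small_of_finite finite_empty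
  obtain ⟨ψ, hψ⟩ := empty_definable_iff.1 (hU ∅ hempty 1 m 1
    ((L.lhomWithConstants (∅ : Set C)).onFormula (φ.relabel Sum.swap)))
  refine ⟨ψ, fun b => ?_⟩
  have hb : IsSmall mu (range b) := h.small_of_finite (finite_range b)
  have hswap : ∀ a : Fin 1 → C, Sum.elim a b ∘ Sum.swap = Sum.elim b fun _ => a 0 := fun a => by
    ext (i | i)
    · rfl
    · exact congrArg a (Subsingleton.elim i 0)
  have hψb : ψ.Realize b ↔ _ := (Set.ext_iff.1 hψ b).symm
  rw [hψb, mem_ofPred_eq, empty_union, h.uRankSet_eq_natCast_iff _ hb]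
  simp only [mem_ofPred_eq, LHom.realize_onFormula, Formula.realize_relabel, hswap]
  have h2 : ∀ a : Fin 1 → C, ¬ RankGE L mu ind (1 + 1 : ℕ) a (range b) := by
    intro a ha
    obtain ⟨l, hlen, hla, hl⟩ := (h.rankGE_natCast_iff _ a hb).1 ha
    have := ((h.indepSeq_nodup hb hl).2.subperm (l₂ := List.ofFn a)
      fun x hx => List.mem_ofFn.2 (hla x hx)).length_le
    simp [hlen] at this
  have h1 : ∀ a : Fin 1 → C, RankGE L mu ind (1 : ℕ) a (range b) ↔
      a 0 ∉ mcl ind (range b) := by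
    intro a
    rw [h.rankGE_natCast_iff _ a hb]
    constructor
    · rintro ⟨l, hlen, hla, hl⟩
      obtain ⟨x, rfl⟩ := List.length_eq_one_iff.1 hlen
      obtain ⟨i, rfl⟩ := hla x (by simp)
      rw [Subsingleton.elim i 0] at hl
      exact hl.1
    · intro ha
      exact ⟨[a 0], rfl, by simp, ha, trivial⟩
  simp only [h1, h2, and_false, exists_false, not_false_eq_true, and_true]
  constructor
  · rintro ⟨a, hφ, ha⟩
    exact ⟨a 0, ha, hφ⟩
  · rintro ⟨c, hc, hφ⟩
    exact ⟨fun _ => c, hφ, hc⟩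

end IsRankOne

end Generic

/-! ### Trees of names for witnesses -/

section Names

/-- Names for the elements of a structure built by repeatedly realizing types: `base j` names a
given element, and `wit p f` a realization of the type labelled `p` over the elements with the
names `f`. -/
inductive Name (α Λ I : Type u) : Type u
  | base : α → Name α Λ I
  | wit : Λ → (I → Name α Λ I) → Name α Λ I

namespace Name

variable {α Λ I : Type u}

/-- The translation of names to a W-type, which bounds their number. -/
def toWType : Name α Λ I → WType (Sum.elim (fun _ : α => PEmpty.{u + 1}) fun _ : Λ => I)
  | base j => WType.mk (Sum.inl j) fun x => PEmpty.elim x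
  | wit p f => WType.mk (Sum.inr p) fun i => (f i).toWType

theorem toWType_injective : Function.Injective (toWType : Name α Λ I → _) := by
  intro x
  induction x with
  | base j =>
    intro y hy
    cases y with
    | base j' => simp only [toWType, WType.mk.injEq, Sum.inl.injEq] at hy; rw [hy.1]
    | wit p f => simp only [toWType, WType.mk.injEq, reduceCtorEq, false_and] at hy
  | wit p f ih =>
    intro y hy
    cases y with
    | base j' => simp only [toWType, WType.mk.injEq, reduceCtorEq, false_and] at hy
    | wit p' f' =>
      simp only [toWType, WType.mk.injEq, Sum.inr.injEq] at hy
      obtain ⟨rfl, h⟩ := hy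
      rw [show f = f' from funext fun i => ih i (congrFun (eq_of_heq h) i)]

theorem card_le {ν : Cardinal.{u}} (hν : ℵ₀ ≤ ν) (hα : #α ≤ 2 ^ ν) (hΛ : #Λ ≤ 2 ^ ν)
    (hI : #I ≤ ν) : #(Name α Λ I) ≤ 2 ^ ν := by
  have h2 : ℵ₀ ≤ (2 : Cardinal.{u}) ^ ν := hν.trans (cantor ν).le
  refine (mk_le_of_injective toWType_injective).trans (WType.cardinalMk_le_of_le ?_)
  have hpow : ((2 : Cardinal.{u}) ^ ν) ^ #I ≤ 2 ^ ν := by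
    rw [← power_mul]
    exact power_le_power_left two_ne_zero ((mul_le_mul' le_rfl hI).trans (mul_eq_self hν).le)
  calc _ ≤ sum (fun _ : α ⊕ Λ => (2 : Cardinal.{u}) ^ ν) := by
        refine sum_le_sum _ _ fun x => ?_
        rcases x with x | x
        · simpa using one_le_aleph0.trans h2
        · exact hpow
    _ = #(α ⊕ Λ) * 2 ^ ν := sum_const' _ _
    _ ≤ 2 ^ ν * 2 ^ ν := by
        refine mul_le_mul' ?_ le_rfl
        rw [mk_sum, lift_id, lift_id]
        exact add_le_of_le h2 hα hΛ
    _ = 2 ^ ν := mul_eq_self h2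

/-- Names can be well-ordered so that a witness comes after the names that it uses. -/
theorem exists_wellOrder_lt_wit (α Λ I : Type u) :
    ∃ (_ : LinearOrder (Name α Λ I)) (_ : WellFoundedLT (Name α Λ I)),
      ∀ (p : Λ) (f : I → Name α Λ I) (i : I), f i < wit p f := by
  classical
  let r : Name α Λ I → Name α Λ I → Prop := fun x y => ∃ p f i, y = wit p f ∧ x = f i
  have hr : WellFounded r := ⟨fun x => by
    induction x with
    | base j => exact ⟨_, fun y ⟨p, f, i, h, _⟩ => by cases h⟩
    | wit p f ih =>
      refine ⟨_, fun y ⟨p', f', i, h, hy⟩ => ?_⟩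
      cases h
      exact hy ▸ ih i⟩
  have : IsWellFounded _ r := ⟨hr⟩
  obtain ⟨s, hrs, hs⟩ := IsWellFounded.exists_well_order_ge r
  let _ : LinearOrder (Name α Λ I) := linearOrderOfSTO s
  exact ⟨inferInstance, ⟨hs.wf⟩, fun p f i => hrs _ _ ⟨p, f, i, rfl, rfl⟩⟩

end Name

end Names

/-! ### Structures closed under witnesses -/

section Witnesses

variable {L : FirstOrder.Language.{u, u}}

/-- A small family of values of names can be enumerated by the index type of the names. -/
theorem exists_enumeration {K Y I ι : Type u} [Nonempty K] (val : K → Y) (hι : #ι ≤ #I)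
    (v : ι → Y) (hv : ∀ i, v i ∈ range val) :
    ∃ (f : I → K) (e : ι → I), ∀ i, val (f (e i)) = v i := by
  choose g hg using hv
  obtain ⟨e⟩ := hι
  refine ⟨Function.extend e g fun _ => Classical.arbitrary K, e, fun i => ?_⟩
  rw [e.injective.extend_apply, hg]

variable {Y : Type u} [L.Structure Y] {K I : Type u} [Nonempty K]

/-- If every type in variables indexed by `I` over values of names is realized by such a value, then
so is every type in fewer variables. -/
theorem exists_realize_of_witnesses (val : K → Y)
    (hval : ∀ (f : I → K) (p : Set (L.Formula (I ⊕ Fin 1))),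
      (∀ s : Finset (L.Formula (I ⊕ Fin 1)), (s : Set _) ⊆ p →
        ∃ c : Y, ∀ φ ∈ s, φ.Realize (Sum.elim (val ∘ f) fun _ => c)) →
      ∃ k, ∀ φ ∈ p, φ.Realize (Sum.elim (val ∘ f) fun _ => val k))
    {ι : Type u} (hι : #ι ≤ #I) (v : ι → Y) (hv : ∀ i, v i ∈ range val)
    (p : Set (L.Formula (ι ⊕ Fin 1)))
    (hp : ∀ s : Finset (L.Formula (ι ⊕ Fin 1)), (s : Set _) ⊆ p →
        ∃ c : Y, ∀ φ ∈ s, φ.Realize (Sum.elim v fun _ => c)) :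
    ∃ k, ∀ φ ∈ p, φ.Realize (Sum.elim v fun _ => val k) := by
  classical
  obtain ⟨f, e, hfe⟩ := exists_enumeration val hι v hv
  have hr : ∀ (φ : L.Formula (ι ⊕ Fin 1)) (c : Y), (φ.relabel (Sum.map e id)).Realize
      (Sum.elim (val ∘ f) fun _ => c) ↔ φ.Realize (Sum.elim v fun _ => c) := by
    intro φ c
    rw [Formula.realize_relabel, Sum.elim_comp_map, Function.comp_id,
      show (val ∘ f) ∘ e = v from funext hfe]
  obtain ⟨k, hk⟩ := hval f (Formula.relabel (Sum.map e id) '' p) (by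
    intro s hs
    obtain ⟨s', hs', rfl⟩ := Finset.subset_set_image_iff.1 hs
    obtain ⟨c, hc⟩ := hp s' hs'
    refine ⟨c, fun φ hφ => ?_⟩
    obtain ⟨ψ, hψ, rfl⟩ := Finset.mem_image.1 hφ
    exact (hr ψ c).2 (hc ψ hψ))
  exact ⟨k, fun φ hφ => (hr φ _).1 (hk _ (mem_image_of_mem _ hφ))⟩

/-- If every type over few values of names is realized by such a value, then the values form a
saturated elementary substructure. -/
theorem exists_elementarySubstructure_of_witnesses [Infinite I] (val : K → Y)
    (hval : ∀ (f : I → K) (p : Set (L.Formula (I ⊕ Fin 1))),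
      (∀ s : Finset (L.Formula (I ⊕ Fin 1)), (s : Set _) ⊆ p →
        ∃ c : Y, ∀ φ ∈ s, φ.Realize (Sum.elim (val ∘ f) fun _ => c)) →
      ∃ k, ∀ φ ∈ p, φ.Realize (Sum.elim (val ∘ f) fun _ => val k)) :
    ∃ M : L.ElementarySubstructure Y, (M : Set Y) = range val ∧
      IsSaturated L M (Order.succ #I) := by
  have hmeet : L.MeetsDefinable (range val) := by
    rintro D ⟨d, hd⟩ hD
    obtain ⟨φ, hφ⟩ := definable_iff_exists_formula_sum.1 hD
    obtain ⟨m, e, ψ, hψ⟩ := exists_finite_left_variables φ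
    have hψY := fun c : Y => hψ Y (↑) fun _ => c
    have hφD : ∀ c : Y, c ∈ D ↔ φ.Realize (Sum.elim (↑) fun _ => c) := fun c =>
      Set.ext_iff.1 hφ fun _ => c
    let ψ' : L.Formula (ULift.{u} (Fin m) ⊕ Fin 1) := ψ.relabel (Sum.map ULift.up id)
    have hψ' : ∀ c : Y, ψ'.Realize (Sum.elim (fun i => ((e i.down : range val) : Y)) fun _ => c) ↔
        c ∈ D := by
      intro c
      rw [hφD, hψY]
      simp only [ψ', Formula.realize_relabel, Sum.elim_comp_map, Function.comp_id]
      rfl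
    obtain ⟨k, hk⟩ := exists_realize_of_witnesses val hval (ι := ULift.{u} (Fin m))
      ((lt_aleph0_of_finite _).le.trans (aleph0_le_mk I)) (fun i => e i.down)
      (fun i => (e i.down).2) {ψ'} (fun s hs => ⟨d, fun φ hφ => by
        rw [show φ = ψ' from hs hφ]
        exact (hψ' d).2 hd⟩)
    exact ⟨val k, (hψ' _).1 (hk ψ' rfl), mem_range_self k⟩
  obtain ⟨M, hM⟩ : ∃ M : L.ElementarySubstructure Y, (M : Set Y) = range val :=
    ⟨hmeet.toElementarySubstructure, hmeet.closure_eq_self⟩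
  refine ⟨M, hM, fun A hA p hp => ?_⟩
  have hr : ∀ (φ : L.Formula (A ⊕ Fin 1)) (c : M), φ.Realize
      (Sum.elim (fun x : A => ((x : M) : Y)) fun _ => (c : Y)) ↔
        φ.Realize (Sum.elim (fun x : A => (x : M)) fun _ => c) := by
    intro φ c
    rw [← M.subtype.map_formula φ]
    have : M.subtype ∘ Sum.elim (fun x : A => (x : M)) (fun _ : Fin 1 => c) =
        Sum.elim (fun x : A => ((x : M) : Y)) fun _ => (c : Y) := by
      ext (x | x) <;> rfl
    rw [this]
  obtain ⟨k, hk⟩ := exists_realize_of_witnesses val hval (Order.lt_succ_iff.1 hA)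
    (fun x : A => ((x : M) : Y)) (fun x => hM ▸ (x : M).2) p (fun s hs => by
      obtain ⟨c, hc⟩ := hp s hs
      exact ⟨c, fun φ hφ => (hr φ c).2 (hc φ hφ)⟩)
  exact ⟨⟨val k, show val k ∈ (M : Set Y) from hM ▸ mem_range_self k⟩,
    fun φ hφ => (hr φ _).1 (hk φ hφ)⟩

theorem mk_set_formula_le {ν : Cardinal.{u}} (hν : ℵ₀ ≤ ν) (hL : L.card ≤ ν) {α : Type u}
    (hα : #α ≤ ν) : #(Set (L.Formula (α ⊕ Fin 1))) ≤ 2 ^ ν := by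
  rw [mk_set]
  refine power_le_power_left two_ne_zero ?_
  have h1 : #(L.Formula (α ⊕ Fin 1)) ≤ #(Σ n, L.BoundedFormula (α ⊕ Fin 1) n) :=
    mk_le_of_injective (f := fun φ => (⟨0, φ⟩ : Σ n, L.BoundedFormula (α ⊕ Fin 1) n))
      (sigma_mk_injective (i := 0))
  refine h1.trans (BoundedFormula.card_le.trans (max_le hν ?_))
  simp only [lift_id]
  refine add_le_of_le hν ?_ hL
  simpa using add_le_of_le hν hα (one_le_aleph0.trans hν)

end Witnesses

/-! ### Saturated models of the eventual theory of a family of structures -/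

section SaturatedUltraproduct

open Filter

/-- Greedy choice of filters along a well-order: those that are compatible with the filters chosen
before are kept. -/
theorem exists_greedy_filters {X K : Type*} [LinearOrder K] [WellFoundedLT K] (F₀ : Filter X)
    [F₀.NeBot] (𝒢 : K → Filter X) : ∃ Q : Set K, (F₀ ⊓ ⨅ j ∈ Q, 𝒢 j).NeBot ∧
      ∀ i ∉ Q, (F₀ ⊓ ⨅ j ∈ Q ∩ Iio i, 𝒢 j) ⊓ 𝒢 i = ⊥ := by
  classical
  let Q : K → Prop := (wellFounded_lt (α := K)).fix fun i q =>
    ((F₀ ⊓ ⨅ j, ⨅ hj : j < i, ⨅ _ : q j hj, 𝒢 j) ⊓ 𝒢 i).NeBot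
  have hQ : ∀ i, Q i ↔ ((F₀ ⊓ ⨅ j ∈ {j | Q j} ∩ Iio i, 𝒢 j) ⊓ 𝒢 i).NeBot := by
    intro i
    have h1 : Q i = _ := (wellFounded_lt (α := K)).fix_eq (fun i (q : ∀ j, j < i → Prop) =>
      ((F₀ ⊓ ⨅ j, ⨅ hj : j < i, ⨅ _ : q j hj, 𝒢 j) ⊓ 𝒢 i).NeBot) i
    rw [h1]
    have h2 : (⨅ j ∈ {j | Q j} ∩ Iio i, 𝒢 j) = ⨅ j, ⨅ _ : j < i, ⨅ _ : Q j, 𝒢 j := by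
      refine iInf_congr fun j => ?_
      rw [inter_comm]
      exact iInf_and
    rw [h2]
  refine ⟨{j | Q j}, ?_, fun i hi => not_not.1 fun hne => hi ((hQ i).2 ⟨hne⟩)⟩
  rw [iInf_subtype', iInf_eq_iInf_finset, inf_iInf]
  refine iInf_neBot_of_directed' ?_ fun t => ?_
  · intro s t
    refine ⟨s ∪ t, inf_le_inf_left _ ?_, inf_le_inf_left _ ?_⟩
    · exact biInf_mono fun j hj => Finset.mem_union_left t hj
    · exact biInf_mono fun j hj => Finset.mem_union_right s hj
  · -- The largest index of a finite set of kept filters was compatible with all the others.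
    by_cases ht : t.Nonempty
    · refine ((hQ _).1 (t.max' ht).2).mono (le_inf (inf_le_left.trans inf_le_left) ?_)
      refine le_iInf₂ fun j hj => ?_
      rcases (t.le_max' j hj).lt_or_eq with hlt | heq
      · exact inf_le_left.trans (inf_le_right.trans (iInf₂_le (j : K) ⟨j.2, hlt⟩))
      · rw [← heq]
        exact inf_le_right
    · rw [Finset.not_nonempty_iff_eq_empty] at ht
      subst ht
      simpa

variable {L : FirstOrder.Language.{u, u}} {T : Type u} (N : T → Type u) [∀ t, L.Structure (N t)]

/-- The assignments of elements of one of the structures `N t` to the names. -/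
abbrev Assignment (K : Type u) : Type u := Σ t : T, K → N t

/-- The assignments for which the name `i` realizes `φ` over the names `f`. -/
def realizeSet {K I : Type u} (f : I → K) (i : K) (φ : L.Formula (I ⊕ Fin 1)) :
    Set (Assignment N K) :=
  {x | φ.Realize (Sum.elim (fun l => x.2 (f l)) fun _ => x.2 i)}

/-- The filter expressing that a name for a witness of `p` realizes `p`. -/
def witnessFilter {α I : Type u} :
    Name α (Set (L.Formula (I ⊕ Fin 1))) I → Filter (Assignment N
      (Name α (Set (L.Formula (I ⊕ Fin 1))) I))
  | .base _ => ⊤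
  | .wit p f => ⨅ φ ∈ p, 𝓟 (realizeSet N f (.wit p f) φ)

/-- The restriction of an assignment to the names other than `i`. -/
def forget {K : Type u} (i : K) (x : Assignment N K) : Σ t : T, {k // k ≠ i} → N t :=
  ⟨x.1, fun k => x.2 k⟩

variable {N}

theorem forget_update {K : Type u} [DecidableEq K] (i : K)
    (x : Assignment N K) (c : N x.1) :
    forget N i (⟨x.1, Function.update x.2 i c⟩ : Assignment N K) = forget N i x := by
  simp only [forget]
  congr 1
  ext k
  exact Function.update_of_ne k.2 c x.2

/-- The condition expressed by the name `j` does not depend on the value of a name `i` that differs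
from `j` and is not used by `j`. -/
theorem witnessFilter_eq_comap {α I : Type u} {j i : Name α (Set (L.Formula (I ⊕ Fin 1))) I}
    (hji : j ≠ i) (hj : ∀ p f, j = .wit p f → ∀ l, f l ≠ i) :
    ∃ G, witnessFilter N j = comap (forget N i) G := by
  cases j with
  | base j => exact ⟨⊤, comap_top.symm⟩
  | wit p f =>
    refine ⟨⨅ φ ∈ p, 𝓟 {z | φ.Realize (Sum.elim (fun l => z.2 ⟨f l, hj p f rfl l⟩)
      fun _ => z.2 ⟨.wit p f, hji⟩)}, ?_⟩
    simp only [comap_iInf, comap_principal]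
    rfl

/-- For a family of structures `N t` with tuples `a t` and a filter on its index set, there is a
saturated structure of bounded cardinality with a tuple that satisfies all formulas which are
eventually satisfied by `a t`.  It consists of the values of all names in an ultraproduct of the
structures `N t` over the set of all assignments. -/
theorem exists_saturated_of_eventually (F : Filter T) [F.NeBot] [∀ t, Nonempty (N t)]
    {α : Type u} (a : ∀ t, α → N t) {ν : Cardinal.{u}} (hν : ℵ₀ ≤ ν) (hL : L.card ≤ ν)
    (hα : #α ≤ 2 ^ ν) :
    ∃ (M : Type u) (_ : L.Structure M) (_ : Nonempty M) (a' : α → M), #M ≤ 2 ^ ν ∧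
      IsSaturated L M (Order.succ ν) ∧
      ∀ φ : L.Formula α, (∀ᶠ t in F, φ.Realize (a t)) → φ.Realize a' := by
  classical
  let I : Type u := ν.out
  have hI : #I = ν := mk_out ν
  have : Infinite I := infinite_iff.2 (hI ▸ hν)
  let K := Name (Option α) (Set (L.Formula (I ⊕ Fin 1))) I
  have hK : #K ≤ 2 ^ ν := Name.card_le hν (by
    rw [mk_option]
    exact add_le_of_le (hν.trans (cantor ν).le) hα (one_le_aleph0.trans (hν.trans (cantor ν).le)))
    (mk_set_formula_le hν hL hI.le) hI.le
  have : Nonempty K := ⟨.base none⟩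
  obtain ⟨_, _, hlt⟩ := Name.exists_wellOrder_lt_wit (Option α) (Set (L.Formula (I ⊕ Fin 1))) I
  let X := Assignment N K
  -- The index is in the sets of `F`, and the names of the given elements have their given values.
  let F₀ : Filter X := comap Sigma.fst F ⊓ 𝓟 {x | ∀ j, x.2 (.base (some j)) = a x.1 j}
  let s : T → X := fun t => ⟨t, fun k => match k with
    | .base (some j) => a t j
    | _ => Classical.arbitrary (N t)⟩
  have hF₀ : F₀.NeBot := by
    refine NeBot.mono (f := map s F) inferInstance (le_inf ?_ ?_)
    · rw [← map_le_iff_le_comap, Filter.map_map]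
      exact le_of_eq Filter.map_id
    · rw [le_principal_iff, mem_map]
      exact univ_mem' fun t j => rfl
  obtain ⟨Q, hQ, hQ'⟩ := exists_greedy_filters F₀ (witnessFilter N : K → Filter X)
  let U : Ultrafilter X := Ultrafilter.of (F₀ ⊓ ⨅ j ∈ Q, witnessFilter N j)
  have hU : (U : Filter X) ≤ F₀ ⊓ ⨅ j ∈ Q, witnessFilter N j := Ultrafilter.of_le _
  let Y := (U : Filter X).Product fun x => N x.1
  let val : K → Y := fun k => ((fun x : X => x.2 k : ∀ x : X, N x.1) : Y)
  have los : ∀ (f : I → K) (g : ∀ x : X, N x.1) (φ : L.Formula (I ⊕ Fin 1)),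
      φ.Realize (Sum.elim (val ∘ f) fun _ => (g : Y)) ↔
        ∀ᶠ x : X in U, φ.Realize (Sum.elim (fun l => x.2 (f l)) fun _ => g x) := by
    intro f g φ
    have := Ultraproduct.realize_formula_cast (u := U) (M := fun x : X => N x.1) φ
      (Sum.elim (fun l x => x.2 (f l)) fun _ => g)
    have e₁ : (Sum.elim (val ∘ f) fun _ : Fin 1 => (g : Y)) = fun i =>
        ((Sum.elim (fun l x => x.2 (f l)) (fun _ => g) i : ∀ x : X, N x.1) : Y) := by
      funext i
      rcases i with i | i <;> rfl
    have e₂ : ∀ x : X, (fun i : I ⊕ Fin 1 => (Sum.elim (fun l x => x.2 (f l)) (fun _ => g) i :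
        ∀ x : X, N x.1) x) = Sum.elim (fun l => x.2 (f l)) fun _ => g x := by
      intro x
      funext i
      rcases i with i | i <;> rfl
    rw [e₁]
    simp only [e₂] at this
    exact this
  have hval : ∀ (f : I → K) (p : Set (L.Formula (I ⊕ Fin 1))),
      (∀ s : Finset (L.Formula (I ⊕ Fin 1)), (s : Set _) ⊆ p →
        ∃ c : Y, ∀ φ ∈ s, φ.Realize (Sum.elim (val ∘ f) fun _ => c)) →
      ∃ k, ∀ φ ∈ p, φ.Realize (Sum.elim (val ∘ f) fun _ => val k) := by
    intro f p hp
    refine ⟨.wit p f, ?_⟩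
    by_cases hi : (Name.wit p f : K) ∈ Q
    · intro φ hφ
      rw [los f]
      have h1 : (U : Filter X) ≤ witnessFilter N (Name.wit p f : K) :=
        hU.trans (inf_le_right.trans (iInf₂_le _ hi))
      exact le_principal_iff.1 (h1.trans (iInf₂_le φ hφ))
    · exfalso
      obtain ⟨S, hS, V, hV, hSV⟩ := inf_eq_bot_iff.1 (hQ' _ hi)
      -- The filter built before the name does not depend on the value of the name.
      have hcomap : ∃ G, F₀ ⊓ (⨅ j ∈ Q ∩ Iio (Name.wit p f : K), witnessFilter N j) =
          comap (forget N (Name.wit p f : K)) G := by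
        have h1 : ∀ j : K, ∃ G, j ∈ Q ∩ Iio (Name.wit p f : K) →
            witnessFilter N j = comap (forget N (Name.wit p f : K)) G := by
          intro j
          by_cases hj : j ∈ Q ∩ Iio (Name.wit p f : K)
          · obtain ⟨G, hG⟩ := witnessFilter_eq_comap (N := N) (i := (Name.wit p f : K))
              (j := j) (ne_of_lt hj.2) (by
                rintro q g rfl l
                exact ne_of_lt ((hlt q g l).trans hj.2))
            exact ⟨G, fun _ => hG⟩
          · exact ⟨⊥, fun h => absurd h hj⟩
        choose G hG using h1
        refine ⟨(comap Sigma.fst F ⊓ 𝓟 {z | ∀ j, z.2 ⟨.base (some j), by simp⟩ = a z.1 j}) ⊓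
          ⨅ j ∈ Q ∩ Iio (Name.wit p f : K), G j, ?_⟩
        simp only [comap_inf, comap_iInf, comap_principal, comap_comap]
        congr 1
        exact iInf_congr fun j => iInf_congr fun hj => hG j hj
      obtain ⟨G, hG⟩ := hcomap
      rw [hG] at hS
      obtain ⟨S', hS', hSS'⟩ := hS
      obtain ⟨t, htp, ht, htV⟩ : ∃ t ⊆ p, t.Finite ∧
          (⋂ φ ∈ t, realizeSet N f (.wit p f : K) φ) ⊆ V := by
        obtain ⟨t, ht, htp, htV⟩ := mem_biInf_principal.1 hV
        exact ⟨t, htp, ht, htV⟩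
      obtain ⟨c, hc⟩ := hp ht.toFinset (by simpa using htp)
      obtain ⟨g, rfl⟩ := Quotient.exists_rep c
      have h1 : ∀ᶠ x : X in U, ∀ φ ∈ t,
          φ.Realize (Sum.elim (fun l => x.2 (f l)) fun _ => g x) :=
        (eventually_all_finite ht).2 fun φ hφ => (los f g φ).1 (hc φ (ht.mem_toFinset.2 hφ))
      have h2 : ∀ᶠ x : X in U, x ∈ forget N (Name.wit p f : K) ⁻¹' S' := by
        have : (U : Filter X) ≤ comap (forget N (Name.wit p f : K)) G := by
          rw [← hG]
          exact hU.trans (inf_le_inf_left _ (biInf_mono fun j hj => hj.1))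
        exact this ⟨S', hS', Subset.rfl⟩
      obtain ⟨x, hx1, hx2⟩ := (h1.and h2).exists
      -- Changing the value of the name to a realization contradicts its incompatibility.
      let y : X := ⟨x.1, Function.update x.2 (Name.wit p f) (g x)⟩
      have hyS : y ∈ S := hSS' (by
        rw [mem_preimage, forget_update]
        exact hx2)
      have hyV : y ∈ V := htV (mem_iInter₂.2 fun φ hφ => by
        have := hx1 φ hφ
        simp only [realizeSet, mem_ofPred_eq, y, Function.update_self]
        convert this using 4 with l
        exact Function.update_of_ne (ne_of_lt (hlt p f l)) _ _)
      exact (hSV ▸ (⟨hyS, hyV⟩ : y ∈ S ∩ V) : y ∈ (∅ : Set X))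
  obtain ⟨M, hM, hMs⟩ := exists_elementarySubstructure_of_witnesses val hval
  have hmem : ∀ k, val k ∈ M := fun k => show val k ∈ (M : Set Y) from hM ▸ mem_range_self k
  refine ⟨M, inferInstance, ⟨⟨val (.base none), hmem _⟩⟩,
    fun j => ⟨val (.base (some j)), hmem _⟩, ?_, hI ▸ hMs, fun φ hφ => ?_⟩
  · have : #M = #(range val) := congrArg (fun S : Set Y => #S) hM
    rw [this]
    exact mk_range_le.trans hK
  · rw [← M.subtype.map_formula φ]
    have := (Ultraproduct.realize_formula_cast (u := U) (M := fun x : X => N x.1) φ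
      fun j x => x.2 (.base (some j))).2 (by
        have h1 : ∀ᶠ x : X in U, φ.Realize (a x.1) :=
          (hU.trans (inf_le_left.trans inf_le_left)) (preimage_mem_comap hφ)
        have h2 : ∀ᶠ x : X in U, ∀ j, x.2 (.base (some j)) = a x.1 j :=
          (hU.trans (inf_le_left.trans inf_le_right)) (mem_principal_self _)
        filter_upwards [h1, h2] with x hx1 hx2
        rwa [show (fun j => x.2 (.base (some j))) = a x.1 from funext hx2])
    exact this

end SaturatedUltraproduct

/-! ### Existence of lovely pairs -/

section Existence

variable {L : FirstOrder.Language.{u, u}} {C : Type u} [L.Structure C] {mu : Cardinal.{u}}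
  {ind : Set C → Set C → Set C → Prop}

/-- The element `c` is a possible value of a name: for a witness, it realizes the type that labels
the name, over the values of the names that it uses; for `b` in `B`, it is `b`. The label of a
witness carries a mark besides the type, and `base none` is there to have a name even if `B` is
empty. -/
def NameRealizes {B : Set C} {I : Type u}
    (v : Name (Option B) (Set (L.Formula (I ⊕ Fin 1)) × Bool) I → C) :
    Name (Option B) (Set (L.Formula (I ⊕ Fin 1)) × Bool) I → C → Prop
  | .base none, _ => True
  | .base (some b), c => c = b
  | .wit q f, c => ∀ φ ∈ q.1, φ.Realize (Sum.elim (v ∘ f) fun _ => c)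

/-- Evaluation of names in the monster model, along a well-order: every name realizes its type and
avoids the closure of `B` and of the preceding values, whenever this is possible. -/
theorem exists_generic_valuation [Nonempty C] {B : Set C} {I : Type u}
    [LinearOrder (Name (Option B) (Set (L.Formula (I ⊕ Fin 1)) × Bool) I)]
    [WellFoundedLT (Name (Option B) (Set (L.Formula (I ⊕ Fin 1)) × Bool) I)]
    (hlt : ∀ (q : Set (L.Formula (I ⊕ Fin 1)) × Bool)
      (f : I → Name (Option B) (Set (L.Formula (I ⊕ Fin 1)) × Bool) I) (i : I),
      f i < .wit q f) :
    ∃ val : Name (Option B) (Set (L.Formula (I ⊕ Fin 1)) × Bool) I → C,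
      ∀ i, (∀ c, NameRealizes val i c → NameRealizes val i (val i)) ∧
        ∀ c, NameRealizes val i c → c ∉ mcl ind (B ∪ val '' Iio i) →
          val i ∉ mcl ind (B ∪ val '' Iio i) := by
  classical
  have step : ∀ i (v : Name (Option B) (Set (L.Formula (I ⊕ Fin 1)) × Bool) I → C), ∃ d,
      (∀ c, NameRealizes v i c → NameRealizes v i d) ∧
        ∀ c, NameRealizes v i c → c ∉ mcl ind (B ∪ v '' Iio i) →
          d ∉ mcl ind (B ∪ v '' Iio i) := by
    intro i v
    by_cases h1 : ∃ c, NameRealizes v i c ∧ c ∉ mcl ind (B ∪ v '' Iio i)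
    · obtain ⟨c, hc, hc'⟩ := h1
      exact ⟨c, fun _ _ => hc, fun _ _ _ => hc'⟩
    · by_cases h2 : ∃ c, NameRealizes v i c
      · obtain ⟨c, hc⟩ := h2
        exact ⟨c, fun _ _ => hc, fun d hd hd' => absurd ⟨d, hd, hd'⟩ h1⟩
      · exact ⟨Classical.arbitrary C, fun d hd => absurd ⟨d, hd⟩ h2,
          fun d hd => absurd ⟨d, hd⟩ h2⟩
  choose F hF using step
  let c₀ : C := Classical.arbitrary C
  let val := (wellFounded_lt (α := Name (Option B) (Set (L.Formula (I ⊕ Fin 1)) × Bool) I)).fix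
    (C := fun _ => C) fun i g => F i fun j => if hj : j < i then g j hj else c₀
  have hval : ∀ i, val i = F i fun j => if j < i then val j else c₀ := by
    intro i
    have := (wellFounded_lt (α := Name (Option B) (Set (L.Formula (I ⊕ Fin 1)) × Bool) I)).fix_eq
      (C := fun _ => C) (fun i g => F i fun j => if hj : j < i then g j hj else c₀) i
    simpa only [dite_eq_ite] using this
  refine ⟨val, fun i => ?_⟩
  have himage : (fun j => if j < i then val j else c₀) '' Iio i = val '' Iio i :=
    image_congr fun j hj => if_pos hj
  have hreal : ∀ c, NameRealizes (fun j => if j < i then val j else c₀) i c ↔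
      NameRealizes val i c := by
    intro c
    cases i with
    | base j => cases j <;> rfl
    | wit q f =>
      have : (fun j => if j < Name.wit q f then val j else c₀) ∘ f = val ∘ f :=
        funext fun l => if_pos (hlt q f l)
      simp only [NameRealizes, this]
  have := hF i fun j => if j < i then val j else c₀
  rw [← hval i, himage] at this
  simpa only [hreal] using this

namespace IsRankOne

/-- A family in which no term lies in the closure of `B` and the preceding terms is
closure-independent over `B`. -/
theorem notMem_mcl_image_of_generic (h : IsRankOne L mu ind) {K : Type u} [LinearOrder K]
    (hK : #K < mu) {B : Set C} (hB : IsSmall mu B) (val : K → C) {G : Set K}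
    (hG : ∀ i ∈ G, val i ∉ mcl ind (B ∪ val '' Iio i)) {i : K} (hi : i ∈ G) :
    val i ∉ mcl ind (B ∪ val '' (G \ {i})) := by
  classical
  have hs : ∀ S : Set K, IsSmall mu (B ∪ val '' S) := fun S =>
    hB.union h.le_mu ((IsSmall.range hK val).mono (image_subset_range val S))
  have key : ∀ F : Finset K, (F : Set K) ⊆ G → ∀ i ∈ G, i ∉ F →
      val i ∉ mcl ind (B ∪ val '' (F : Set K)) := by
    intro F
    induction F using Finset.induction_on_max with
    | empty =>
      intro _ i hi _
      exact mt (fun hc => h.mcl_mono (hs (Iio i)) (by simp) hc) (hG i hi)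
    | insert k F hk ih =>
      intro hF i hi hiF hc
      rw [Finset.coe_insert, insert_subset_iff] at hF
      rw [Finset.mem_insert, not_or] at hiF
      rcases lt_or_gt_of_ne hiF.1 with hik | hki
      · rw [Finset.coe_insert, image_insert_eq, union_insert] at hc
        have := h.exchange (hs F) hc (ih hF.2 i hi hiF.2)
        refine hG k hF.1 (h.mcl_mono (hs _) ?_ this)
        rw [← union_insert, ← image_insert_eq]
        refine union_subset_union_right B (image_mono ?_)
        exact insert_subset_iff.2 ⟨hik, fun x hx => hk x hx⟩
      · refine hG i hi (h.mcl_mono (hs _) (union_subset_union_right B (image_mono ?_)) hc)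
        rw [Finset.coe_insert]
        exact insert_subset_iff.2 ⟨hki, fun x hx => (hk x hx).trans hki⟩
  intro hc
  obtain ⟨S, hS, hSf, hcS⟩ := h.exists_finite_of_mem_mcl (hs _) hc
  obtain ⟨F, hF, hFS⟩ : ∃ F : Finset K, (F : Set K) ⊆ G \ {i} ∧ S ⊆ B ∪ val '' (F : Set K) := by
    have hSf' : (S ∩ val '' (G \ {i})).Finite := hSf.inter_of_left _
    obtain ⟨F, hF, hFi⟩ := exists_subset_image_finite_and.1
      ⟨_, (inter_subset_right : S ∩ val '' (G \ {i}) ⊆ _), hSf', rfl⟩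
    refine ⟨hFi.1.toFinset, by simpa using hF, fun x hx => ?_⟩
    rcases hS hx with hxB | hxG
    · exact Or.inl hxB
    · refine Or.inr ?_
      rw [Set.Finite.coe_toFinset, ← hFi.2]
      exact ⟨hx, hxG⟩
  exact key F (hF.trans sdiff_subset) i hi (fun hiF => (hF hiF).2 rfl)
    (h.mcl_mono (hs _) hFS hcS)

/-- A family is contained in the closure of `B` and those of its terms that do not lie in the
closure of `B` and the preceding terms. -/
theorem mem_mcl_image_generic (h : IsRankOne L mu ind) {K : Type u} [LinearOrder K]
    [WellFoundedLT K] (hK : #K < mu) {B : Set C} (hB : IsSmall mu B) (val : K → C) {G : Set K}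
    (hG : ∀ i ∉ G, val i ∈ mcl ind (B ∪ val '' Iio i)) (i : K) :
    val i ∈ mcl ind (B ∪ val '' (G ∩ Iic i)) := by
  have hs : ∀ S : Set K, IsSmall mu (B ∪ val '' S) := fun S =>
    hB.union h.le_mu ((IsSmall.range hK val).mono (image_subset_range val S))
  induction i using (wellFounded_lt (α := K)).induction with
  | _ i ih =>
    by_cases hi : i ∈ G
    · exact h.subset_mcl (hs _) (Or.inr (mem_image_of_mem _ ⟨hi, le_rfl⟩))
    · refine h.mem_mcl_of_mem_mcl_union (hs _) (hs (Iio i)) (union_subset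
        (subset_union_left.trans (h.subset_mcl (hs _))) ?_)
        (h.mcl_mono ((hs _).union h.le_mu (hs _)) subset_union_right (hG i hi))
      rintro _ ⟨j, hj, rfl⟩
      exact h.mcl_mono (hs _) (union_subset_union_right B (image_mono
        (inter_subset_inter_right G (Iic_subset_Iic.2 (le_of_lt hj))))) (ih j hj)

/-- Every small set is contained in the predicate of a lovely pair.  The universe of the pair
consists of the values of all names; its predicate is the closure of the given set and those generic
values whose names are marked `true`. -/
theorem exists_isLovely (h : IsRankOne L mu ind) [Nonempty C] {κ : Cardinal.{u}} (hκ : ℵ₀ ≤ κ)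
    (hL : L.card ≤ κ) (hκmu : κ < mu) {B : Set C} (hB : #B ≤ 2 ^ κ) :
    ∃ (M : L.ElementarySubstructure C) (P : Set C), IsLovely mu ind κ M P ∧ B ⊆ P := by
  classical
  let I : Type u := κ.out
  have hI : #I = κ := mk_out κ
  have : Infinite I := infinite_iff.2 (hI ▸ hκ)
  let K := Name (Option B) (Set (L.Formula (I ⊕ Fin 1)) × Bool) I
  have h2κ : ℵ₀ ≤ (2 : Cardinal.{u}) ^ κ := hκ.trans (cantor κ).le
  have hK : #K < mu := by
    refine lt_of_le_of_lt (Name.card_le hκ ?_ ?_ hI.le)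
      (h.monster.strongLimit.isStrongPrelimit hκmu)
    · rw [mk_option]
      exact add_le_of_le h2κ hB (one_le_aleph0.trans h2κ)
    · rw [mk_prod, lift_uzero, mk_bool, lift_ofNat]
      exact mul_le_of_le h2κ (mk_set_formula_le hκ hL hI.le)
        ((natCast_lt_aleph0 (n := 2)).le.trans h2κ)
  have hBs : IsSmall mu B := hB.trans_lt (h.monster.strongLimit.isStrongPrelimit hκmu)
  have : Nonempty K := ⟨.base none⟩
  obtain ⟨_, _, hlt⟩ :=
    Name.exists_wellOrder_lt_wit (Option B) (Set (L.Formula (I ⊕ Fin 1)) × Bool) I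
  obtain ⟨val, hval⟩ := exists_generic_valuation (ind := ind) (L := L) (B := B) (I := I) hlt
  obtain ⟨M, hM, -⟩ := exists_elementarySubstructure_of_witnesses (L := L) (I := I) val (by
    intro f p hp
    obtain ⟨c, hc⟩ := h.monster.saturated.exists_realize (hI ▸ hκmu) (val ∘ f) p hp
    exact ⟨.wit (p, true) f, (hval (.wit (p, true) f)).1 c hc⟩)
  have hMs : IsSmall mu (M : Set C) := hM ▸ IsSmall.range hK val
  have hs : ∀ S : Set K, IsSmall mu (B ∪ val '' S) := fun S =>
    hBs.union h.le_mu ((IsSmall.range hK val).mono (image_subset_range val S))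
  let G : Set K := {i | val i ∉ mcl ind (B ∪ val '' Iio i)}
  have hGind : ∀ i ∈ G, val i ∉ mcl ind (B ∪ val '' (G \ {i})) := fun i hi =>
    h.notMem_mcl_image_of_generic hK hBs val (fun i hi => hi) hi
  have hGspan : ∀ i, val i ∈ mcl ind (B ∪ val '' (G ∩ Iic i)) :=
    h.mem_mcl_image_generic hK hBs val (fun i hi => not_not.1 hi)
  let GP : Set K := {i | i ∈ G ∧ ∃ p f, i = .wit (p, true) f}
  let P : Set C := {x | x ∈ (M : Set C) ∧ x ∈ mcl ind (B ∪ val '' GP)}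
  have hPs : IsSmall mu P := hMs.mono fun x hx => hx.1
  have realization : ∀ A : Set C, A ⊆ M → #A < κ → ∀ (c : C) (t : Bool),
      ∃ p f, SameType₁ L A c (val (.wit (p, t) f)) ∧ A ⊆ val '' Iio (.wit (p, t) f) ∧
        (c ∉ mcl ind A → (.wit (p, t) f : K) ∈ G) := by
    intro A hA hAκ c t
    have hAs : IsSmall mu A := hAκ.trans hκmu
    -- A conjugate of `c` over `A` that is generic over all values, if `c` is generic over `A`: its
    -- type is the label of a name whose value is then generic.
    obtain ⟨c₁, hc₁, hcc₁⟩ : ∃ c₁, (c ∉ mcl ind A → c₁ ∉ mcl ind (A ∪ (B ∪ val '' univ))) ∧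
        SameType₁ L A c c₁ := by
      by_cases hc : c ∈ mcl ind A
      · exact ⟨c, fun hc' => absurd hc hc', fun φ => Iff.rfl⟩
      · obtain ⟨σ, hσ, hσc⟩ := h.exists_equiv_notMem_mcl (hs univ) hAs hc
        exact ⟨σ c, fun _ => hσc, sameType₁_of_equiv σ hσ c⟩
    obtain ⟨f, e, hfe⟩ := exists_enumeration (I := I) val (hI ▸ hAκ.le) (fun x : A => (x : C))
      (fun x => hM ▸ hA x.2)
    let p : Set (L.Formula (I ⊕ Fin 1)) := {φ | φ.Realize (Sum.elim (val ∘ f) fun _ => c₁)}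
    have hp : NameRealizes val (.wit (p, t) f) c₁ := fun φ hφ => hφ
    refine ⟨p, f, hcc₁.trans fun φ => ?_, fun x hx => ⟨f (e ⟨x, hx⟩), hlt _ _ _, hfe ⟨x, hx⟩⟩,
      fun hc => (hval _).2 c₁ hp (mt (fun hc' => h.mcl_mono (hAs.union h.le_mu (hs univ))
        (subset_union_right.trans' (union_subset_union_right B (image_mono (subset_univ _))))
        hc') (hc₁ hc))⟩
    have hr : ∀ c : C, (φ.relabel (Sum.map e id)).Realize (Sum.elim (val ∘ f) fun _ => c) ↔
        φ.Realize (Sum.elim (fun x : A => (x : C)) fun _ => c) := by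
      intro c
      rw [Formula.realize_relabel, Sum.elim_comp_map, Function.comp_id,
        show (val ∘ f) ∘ e = fun x : A => (x : C) from funext hfe]
    have himp : ∀ ψ : L.Formula (I ⊕ Fin 1), ψ.Realize (Sum.elim (val ∘ f) fun _ => c₁) →
        ψ.Realize (Sum.elim (val ∘ f) fun _ => val (.wit (p, t) f)) :=
      (hval _).1 c₁ hp
    rw [← hr, ← hr]
    refine ⟨himp _, fun hφ => ?_⟩
    by_contra hn
    exact himp (Formula.not _) (Formula.realize_not.2 hn) hφ
  have hmem : ∀ k, val k ∈ (M : Set C) := fun k => hM ▸ mem_range_self k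
  refine ⟨M, P, ⟨hMs, fun x hx => hx.1, ?_, ?_⟩, fun b hb => ⟨?_, h.subset_mcl (hs _) (Or.inl hb)⟩⟩
  · intro A hA hAκ c hi
    have hAs : IsSmall mu A := hAκ.trans hκmu
    obtain ⟨p, f, hcd, -, hgen⟩ := realization A hA hAκ c true
    refine ⟨_, ⟨hmem _, ?_⟩, hcd⟩
    by_cases hc : c ∈ mcl ind A
    · have hPA : IsSmall mu (P ∩ A) := hAs.mono inter_subset_right
      have hc' : c ∈ mcl ind (P ∩ A) := by
        by_contra hn
        exact h.notMem_mcl_of_ind hPA hAs inter_subset_right hi hn hc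
      have hd := (h.mem_mcl_iff_of_sameType₁ hPA (hcd.mono inter_subset_right)).1 hc'
      exact h.mem_mcl_of_mem_mcl_union (hs _) hPA (fun x hx => hx.1.2)
        (h.mcl_mono ((hs _).union h.le_mu hPA) subset_union_right hd)
    · exact h.subset_mcl (hs _) (Or.inr (mem_image_of_mem _ ⟨hgen hc, p, f, rfl⟩))
  · intro A hA hAκ c
    have hAs : IsSmall mu A := hAκ.trans hκmu
    obtain ⟨p, f, hcd, hAlt, hgen⟩ := realization A hA hAκ c false
    refine ⟨_, hmem _, hcd, ?_⟩
    by_cases hc : c ∈ mcl ind A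
    · exact h.ind_of_mem_mcl hAs hPs ((h.mem_mcl_iff_of_sameType₁ hAs hcd).1 hc)
    · have hAP := hAs.union h.le_mu hPs
      refine h.ind_mono_right (h.small_singleton _) hAs hAP (h.ind_of_notMem_mcl hAP
        subset_union_left ?_) subset_union_right
      intro hd
      -- The closure of `A ∪ P` is spanned by `B` and generic values whose names either precede the
      -- name of the witness or are marked `true`.
      refine hGind _ (hgen hc) (h.mem_mcl_of_mem_mcl_union (hs _) hAP (union_subset ?_ ?_)
        (h.mcl_mono ((hs _).union h.le_mu hAP) subset_union_right hd))
      · intro x hx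
        obtain ⟨j, hj, rfl⟩ := hAlt hx
        refine h.mcl_mono (hs _) (union_subset_union_right B (image_mono ?_)) (hGspan j)
        exact fun l hl => ⟨hl.1, ne_of_lt (lt_of_le_of_lt hl.2 hj)⟩
      · intro x hx
        refine h.mcl_mono (hs _) (union_subset_union_right B (image_mono ?_)) hx.2
        rintro l ⟨hlG, q, g, rfl⟩
        refine ⟨hlG, fun heq => ?_⟩
        simp at heq
  · have : val (.base (some ⟨b, hb⟩)) = b := (hval (.base (some ⟨b, hb⟩))).1 b rfl
    rw [← this]
    exact hmem _

end IsRankOne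

end Existence

/-! ### Formulas in pairs -/

section PairFormulas

variable {L : FirstOrder.Language.{u, u}} {C : Type u} [L.Structure C]
  {M : L.ElementarySubstructure C} {P : Set C}

/-- An element of the universe of a pair, as an element of the monster model. -/
def PairModel.val (x : PairModel M P) : C := ((show M from x : M) : C)

theorem PairModel.val_mem (x : PairModel M P) : x.val ∈ (M : Set C) := (show M from x).2

instance [Nonempty C] : Nonempty (PairModel M P) := inferInstanceAs (Nonempty M)

/-- An `L`-formula, as a formula in the language of pairs. -/
def pairLift {ι : Type*} (φ : L.Formula ι) : (pairLang L).Formula ι :=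
  (LHom.sumInl : L →ᴸ pairLang L).onFormula φ

/-- The predicate symbol of the language of pairs. -/
def predSymbol (L : FirstOrder.Language.{u, u}) : (pairLang L).Relations 1 :=
  Sum.inr PredRel.P

/-- The formula `P(i)` in the language of pairs. -/
def predFormula (L : FirstOrder.Language.{u, u}) {ι : Type*} (i : ι) : (pairLang L).Formula ι :=
  (predSymbol L).formula₁ (Term.var i)

theorem realize_pairLift {ι : Type*} (φ : L.Formula ι) (v : ι → PairModel M P) :
    (pairLift φ).Realize v ↔ φ.Realize fun i => (v i).val := by
  rw [pairLift, LHom.realize_onFormula]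
  exact (M.subtype.map_formula φ v).symm

theorem realize_predFormula {ι : Type*} (i : ι) (v : ι → PairModel M P) :
    (predFormula L i).Realize v ↔ (v i).val ∈ P := by
  rw [predFormula, Formula.realize_rel₁]
  rfl

theorem comp_val_elim {ι : Type*} (v : ι → PairModel M P) (x : PairModel M P) :
    (fun i => PairModel.val (Sum.elim v (fun _ : Fin 1 => x) i)) =
      Sum.elim (fun i => (v i).val) fun _ => x.val := by
  ext (i | i) <;> rfl

theorem realize_pairLift_elim {ι : Type*} (φ : L.Formula (ι ⊕ Fin 1)) (v : ι → PairModel M P)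
    (x : PairModel M P) : (pairLift φ).Realize (Sum.elim v fun _ => x) ↔
      φ.Realize (Sum.elim (fun i => (v i).val) fun _ => x.val) := by
  rw [realize_pairLift, comp_val_elim]

theorem IsSaturated.of_equiv {L : FirstOrder.Language.{u, u}} {N N' : Type u} [L.Structure N]
    [L.Structure N'] {lam : Cardinal.{u}} (h : IsSaturated L N lam) (e : N ≃[L] N') :
    IsSaturated L N' lam := by
  intro A hA p hp
  have he : ∀ (φ : L.Formula (A ⊕ Fin 1)) (c : N),
      φ.Realize (Sum.elim (fun x : A => e.symm x) fun _ => c) ↔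
        φ.Realize (Sum.elim (fun x : A => (x : N')) fun _ => e c) := by
    intro φ c
    rw [← StrongHomClass.realize_formula e φ]
    have : e ∘ Sum.elim (fun x : A => e.symm x) (fun _ : Fin 1 => c) =
        Sum.elim (fun x : A => (x : N')) fun _ => e c := by
      ext (x | x)
      · exact e.apply_symm_apply x
      · rfl
    rw [this]
  obtain ⟨c, hc⟩ := h.exists_realize hA (fun x : A => e.symm x) p (fun s hs => by
    obtain ⟨c, hc⟩ := hp s hs
    refine ⟨e.symm c, fun φ hφ => (he φ _).2 ?_⟩
    rw [e.apply_symm_apply]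
    exact hc φ hφ)
  exact ⟨e c, fun φ hφ => (he φ c).1 (hc φ hφ)⟩

variable {mu : Cardinal.{u}}

/-- A small model of the complete theory of the monster model, expanded by a predicate, is
isomorphic to a pair. -/
theorem IsMonster.exists_pair_equiv (hC : IsMonster L C mu) [Nonempty C] (N : Type u)
    [(pairLang L).Structure N] [Nonempty N] (hN : #N < mu)
    (hT : Theory.Model N ((LHom.sumInl : L →ᴸ pairLang L).onTheory (L.completeTheory C))) :
    ∃ (M : L.ElementarySubstructure C) (P : Set C), IsSmall mu (M : Set C) ∧ P ⊆ M ∧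
      Nonempty (N ≃[pairLang L] PairModel M P) := by
  let _ : L.Structure N := (LHom.sumInl : L →ᴸ pairLang L).reduct N
  have hexp : (LHom.sumInl : L →ᴸ pairLang L).IsExpansionOn N := LHom.isExpansionOn_reduct _ _
  have hT' : Theory.Model N (L.completeTheory C) := (LHom.onTheory_model _ _).1 hT
  -- The elementary diagram of the reduct is realized in the monster model.
  obtain ⟨f, hf⟩ := hC.saturated.exists_realize_all hN {φ : L.Formula N | φ.Realize id} (by
    intro s hs
    by_contra! hcon
    obtain ⟨σ, hσ⟩ := exists_sentence_iff_forall_realize.{u, u, u} (conj s).not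
    have h1 : C ⊨ σ := (hσ C).2 fun w => Formula.realize_not.2 fun hw => by
      obtain ⟨φ, hφ, hφw⟩ := hcon w
      exact hφw (realize_conj.1 hw φ hφ)
    have h2 : N ⊨ σ := hT'.realize_of_mem σ h1
    exact Formula.realize_not.1 ((hσ N).1 h2 id) (realize_conj.2 fun φ hφ => hs hφ))
  have hfiff : ∀ φ : L.Formula N, φ.Realize f ↔ φ.Realize id := fun φ =>
    ⟨fun h => by_contra fun hn => Formula.realize_not.1 (hf φ.not (Formula.realize_not.2 hn)) h,
      hf φ⟩
  let F : N ↪ₑ[L] C := ⟨f, fun n φ x => by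
    have := hfiff (φ.relabel x)
    simpa only [Formula.realize_relabel, Function.id_comp] using this⟩
  have hF : ∀ n, F n = f n := fun _ => rfl
  have hmeet : L.MeetsDefinable (range f) := by
    rintro D ⟨d, hd⟩ hD
    obtain ⟨φ, hφ⟩ := definable_iff_exists_formula_sum.1 hD
    choose g hg using fun y : range f => y.2
    have hr : ∀ c : C, (φ.relabel (Sum.map g id)).Realize (Sum.elim f fun _ => c) ↔ c ∈ D := by
      intro c
      rw [Formula.realize_relabel, Sum.elim_comp_map, Function.comp_id,
        show f ∘ g = fun y : range f => (y : C) from funext hg]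
      exact (Set.ext_iff.1 hφ fun _ => c).symm
    obtain ⟨n, hn⟩ := realize_exLast.1 ((hfiff _).1 (realize_exLast.2 ⟨d, (hr d).2 hd⟩))
    refine ⟨f n, (hr (f n)).1 ?_, mem_range_self n⟩
    rw [← F.map_formula] at hn
    convert hn using 1
    ext (i | i) <;> rfl
  obtain ⟨M, hM⟩ : ∃ M : L.ElementarySubstructure C, (M : Set C) = range f :=
    ⟨hmeet.toElementarySubstructure, hmeet.closure_eq_self⟩
  have hfM : ∀ n, f n ∈ (M : Set C) := fun n => hM ▸ mem_range_self n
  let P : Set C := f '' {n | Structure.RelMap (predSymbol L) ![n]}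
  refine ⟨M, P, hM ▸ IsSmall.range hN f, ?_, ?_⟩
  · rintro _ ⟨n, -, rfl⟩
    exact hfM n
  have hinj : Function.Injective f := F.injective
  let e : N ≃ PairModel M P := Equiv.ofBijective (fun n => (⟨f n, hfM n⟩ : M))
    ⟨fun x y hxy => hinj (congrArg Subtype.val hxy), fun y => by
      obtain ⟨n, hn⟩ : (show M from y : C) ∈ range f := hM ▸ (show M from y).2
      exact ⟨n, Subtype.ext hn⟩⟩
  refine ⟨⟨e, ?_, ?_⟩⟩
  · rintro n (g | g) x
    · exact Subtype.ext (F.map_fun g x)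
    · exact g.elim
  · rintro n (r | r) x
    · exact F.map_rel r x
    · cases r
      have hx : x = ![x 0] := by
        ext i
        rw [Subsingleton.elim i 0]
        rfl
      constructor
      · rintro ⟨y, hy, hyx⟩
        have : y = x 0 := hinj hyx
        rw [hx, ← this]
        exact hy
      · intro hr
        rw [hx] at hr
        exact ⟨x 0, hr, rfl⟩

end PairFormulas

/-! ### Closure and genericity in lovely pairs -/

section LovelyFacts

variable {L : FirstOrder.Language.{u, u}} {C : Type u} [L.Structure C] {mu κ : Cardinal.{u}}
  {ind : Set C → Set C → Set C → Prop} {M : L.ElementarySubstructure C} {P : Set C}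

theorem IsLovely.small_pred (hl : IsLovely mu ind κ M P) : IsSmall mu P := hl.small.mono hl.subset

/-- The predicate of a lovely pair is closed in its universe. -/
theorem IsLovely.mem_of_mem_mcl (hl : IsLovely mu ind κ M P) (h : IsRankOne L mu ind) (hκ : ℵ₀ ≤ κ)
    {x : C} (hx : x ∈ (M : Set C)) (hxP : x ∈ mcl ind P) : x ∈ P := by
  obtain ⟨P₀, hP₀, hf, hx₀⟩ := h.exists_finite_of_mem_mcl hl.small_pred hxP
  have hA : (insert x P₀).Finite := hf.insert x
  have hPA : IsSmall mu (P ∩ insert x P₀) := h.small_of_finite (hA.inter_of_right P)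
  obtain ⟨d, hd, hxd⟩ := hl.density (insert x P₀) (insert_subset hx (hP₀.trans hl.subset))
    ((lt_aleph0_iff_set_finite.2 hA).trans_le hκ) x (h.ind_of_mem_mcl hPA (h.small_of_finite hA)
      (h.mcl_mono hPA (subset_inter hP₀ (subset_insert x P₀)) hx₀))
  rwa [← hxd.eq_of_mem (mem_insert x P₀)]

theorem IsLovely.exists_mem_pred (hl : IsLovely mu ind κ M P) (h : IsRankOne L mu ind)
    (hκmu : κ < mu) {A : Set C} (hA : A ⊆ M) (hAκ : #A < κ) {c : C} (hc : c ∉ mcl ind A) :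
    ∃ d ∈ P, SameType₁ L A c d :=
  hl.density A hA hAκ c (h.ind_of_notMem_mcl (hAκ.trans hκmu) inter_subset_right hc)

theorem IsLovely.exists_notMem_mcl (hl : IsLovely mu ind κ M P) (h : IsRankOne L mu ind)
    (hκmu : κ < mu) {A : Set C} (hA : A ⊆ M) (hAκ : #A < κ) {c : C} (hc : c ∉ mcl ind A) :
    ∃ d ∈ M, SameType₁ L A c d ∧ d ∉ mcl ind (A ∪ P) := by
  have hAs : IsSmall mu A := hAκ.trans hκmu
  obtain ⟨d, hd, hcd, hi⟩ := hl.extension A hA hAκ c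
  exact ⟨d, hd, hcd, h.notMem_mcl_of_ind hAs (hAs.union h.le_mu hl.small_pred) subset_union_left
    (h.ind_base_union (h.small_singleton d) hAs hl.small_pred hi)
    (mt (h.mem_mcl_iff_of_sameType₁ hAs hcd).2 hc)⟩

theorem SameType₁.realize_elim {ι : Type*} {b : ι → C} {c d : C}
    (h : SameType₁ L (range b) c d) {φ : L.Formula (ι ⊕ Fin 1)}
    (hφ : φ.Realize (Sum.elim b fun _ => c)) : φ.Realize (Sum.elim b fun _ => d) := by
  have hr : ∀ c : C, (φ.relabel (Sum.map (rangeFactorization b) id)).Realize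
      (Sum.elim (fun x : range b => (x : C)) fun _ => c) ↔
        φ.Realize (Sum.elim b fun _ => c) := by
    intro c
    rw [Formula.realize_relabel, Sum.elim_comp_map, Function.comp_id]
    rfl
  exact (hr d).1 ((h _).1 ((hr c).2 hφ))

/-- Over a tuple in the predicate of a lovely pair, the generic quantifier becomes the quantifier
"there is an element outside the predicate". -/
theorem IsLovely.exists_notMem_mcl_iff (hl : IsLovely mu ind κ M P) (h : IsRankOne L mu ind)
    (hκ : ℵ₀ ≤ κ) (hκmu : κ < mu) {ι : Type*} [Finite ι] (φ : L.Formula (ι ⊕ Fin 1)) (b : ι → C)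
    (hb : ∀ i, b i ∈ P) : (∃ c, c ∉ mcl ind (range b) ∧ φ.Realize (Sum.elim b fun _ => c)) ↔
      ∃ c ∈ M, c ∉ P ∧ φ.Realize (Sum.elim b fun _ => c) := by
  have hbP : range b ⊆ P := range_subset_iff.2 hb
  constructor
  · rintro ⟨c, hc, hφ⟩
    obtain ⟨d, hd, hcd, hdP⟩ := hl.exists_notMem_mcl h hκmu (hbP.trans hl.subset)
      ((lt_aleph0_iff_set_finite.2 (finite_range b)).trans_le hκ) hc
    have hs := h.small_of_finite (finite_range b)
    exact ⟨d, hd, fun hdP' => hdP (h.subset_mcl (hs.union h.le_mu hl.small_pred) (Or.inr hdP')),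
      hcd.realize_elim hφ⟩
  · rintro ⟨c, hc, hcP, hφ⟩
    exact ⟨c, fun hcb => hcP (hl.mem_of_mem_mcl h hκ hc (h.mcl_mono hl.small_pred hbP hcb)), hφ⟩

end LovelyFacts

/-! ### First-order loveliness implies definability of the rank -/

section FirstOrderImpliesDefinable

variable {L : FirstOrder.Language.{u, u}} {C : Type u} [L.Structure C] {mu κ : Cardinal.{u}}
  {ind : Set C → Set C → Set C → Prop}

/-- A property of finite tuples of a monster model is definable as soon as every tuple satisfies a
formula that decides it. -/
theorem IsMonster.exists_formula_of_locally_decided (hC : IsMonster L C mu) [Nonempty C] {m : ℕ}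
    (G : (Fin m → C) → Prop) (hG : ∀ b, ∃ θ : L.Formula (Fin m), θ.Realize b ∧
      ∀ b', θ.Realize b' → (G b' ↔ G b)) : ∃ ψ : L.Formula (Fin m), ∀ b, ψ.Realize b ↔ G b := by
  classical
  choose θ hθ hθG using hG
  let lift : L.Formula (Fin m) → L.Formula (ULift.{u} (Fin m)) := Formula.relabel ULift.up
  have hlift : ∀ (φ : L.Formula (Fin m)) (w : ULift.{u} (Fin m) → C),
      (lift φ).Realize w ↔ φ.Realize fun i => w ⟨i⟩ := fun φ w => Formula.realize_relabel
  obtain ⟨t, ht⟩ : ∃ t : Finset (Fin m → C), ∀ b, ∃ b' ∈ t, (θ b').Realize b := by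
    by_contra! hcon
    obtain ⟨w, hw⟩ := hC.saturated.exists_realize_all (K := ULift.{u} (Fin m))
      ((lt_aleph0_of_finite _).trans_le hC.aleph0_le)
      ((fun b => lift (θ b).not) '' univ) (by
        intro s hs
        obtain ⟨t, -, rfl⟩ := Finset.subset_set_image_iff.1 hs
        obtain ⟨b, hb⟩ := hcon t
        refine ⟨fun i => b i.down, fun φ hφ => ?_⟩
        obtain ⟨b', hb', rfl⟩ := Finset.mem_image.1 hφ
        exact (hlift _ _).2 (Formula.realize_not.2 (hb b' hb')))
    exact Formula.realize_not.1 ((hlift _ _).1 (hw _ (mem_image_of_mem _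
      (mem_univ fun i => w ⟨i⟩)))) (hθ _)
  refine ⟨Formula.iSup fun b : {b : t // G b} => θ b, fun b => ?_⟩
  rw [Formula.realize_iSup]
  constructor
  · rintro ⟨⟨b', hb'⟩, hr⟩
    exact (hθG _ _ hr).2 hb'
  · intro hb
    obtain ⟨b', hb', hr⟩ := ht b
    exact ⟨⟨⟨b', hb'⟩, (hθG _ _ hr).1 hb⟩, hr⟩

theorem realize_relabel_sentence {L : FirstOrder.Language.{u, u}} {N α : Type*} [L.Structure N]
    (σ : L.Sentence) (v : α → N) :
    (Formula.relabel Empty.elim σ : L.Formula α).Realize v ↔ N ⊨ σ := by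
  rw [Formula.realize_relabel, Sentence.Realize, Subsingleton.elim (v ∘ Empty.elim) default]

theorem card_pairLang_le {ν : Cardinal.{u}} (hν : ℵ₀ ≤ ν) (hL : L.card ≤ ν) :
    (pairLang L).card ≤ ν := by
  rw [Language.card_sum]
  refine add_le_of_le hν (by simpa using hL) ?_
  have hcard : predLang.card ≤ 1 := le_one_iff_subsingleton.2 ⟨by
    rintro (⟨n, f⟩ | ⟨n, r⟩) (⟨n', f'⟩ | ⟨n', r'⟩)
    · exact f.elim
    · exact f.elim
    · exact f'.elim
    · cases r
      cases r'
      rfl⟩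
  exact (lift_le_one_iff.2 hcard).trans (one_le_aleph0.trans hν)

namespace IsRankOne

/-- In lovely pairs the generic quantifier is first-order over the predicate.  If no formula true
at `b` decided it, then lovely pairs containing tuples that approximate the type of `b` but disagree
with `b` would give rise to a saturated pair, again lovely, containing a conjugate of `b` that
disagrees with `b`. -/
theorem genericDefinable_of_lovelinessFirstOrder (h : IsRankOne L mu ind) [Nonempty C]
    (hκ : ℵ₀ ≤ κ) (hL : L.card ≤ κ) (hκmu : κ < mu) (hfo : LovelinessFirstOrder L mu ind κ) :
    GenericDefinable L ind := by
  classical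
  obtain ⟨T', hTT', hT', lam, hlam, hsat⟩ := hfo
  intro m φ
  let G : (Fin m → C) → Prop := fun b =>
    ∃ c, c ∉ mcl ind (range b) ∧ φ.Realize (Sum.elim b fun _ => c)
  refine h.monster.exists_formula_of_locally_decided G fun b => ?_
  by_contra hcon
  -- Every finite part of the type of `b` is realized by a tuple that disagrees with `b`.
  have happrox : ∀ s : Finset {θ : L.Formula (Fin m) // θ.Realize b},
      ∃ b' : Fin m → C, (∀ θ ∈ s, (θ : L.Formula (Fin m)).Realize b') ∧ ¬ (G b' ↔ G b) := by
    intro s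
    by_contra! hn
    refine hcon ⟨conj (s.image Subtype.val), realize_conj.2 fun θ hθ => ?_, fun b' hb' => ?_⟩
    · obtain ⟨θ', -, rfl⟩ := Finset.mem_image.1 hθ
      exact θ'.2
    · exact hn b' fun θ hθ => realize_conj.1 hb' _ (Finset.mem_image_of_mem _ hθ)
  choose b' hb' hG using happrox
  choose M P hl hbP using fun s => h.exists_isLovely hκ hL hκmu (B := range (b' s))
    ((lt_aleph0_iff_set_finite.2 (finite_range _)).le.trans (hκ.trans (cantor κ).le))
  -- The formula "there is `x ∉ P` with `φ(b, x)`" expresses `G b` for `b` in the predicate.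
  let γ : (pairLang L).Formula (Fin m) := exLast (pairLift φ ⊓ (predFormula L (Sum.inr 0)).not)
  have hγ : ∀ (M : L.ElementarySubstructure C) (P : Set C), IsLovely mu ind κ M P →
      ∀ v : Fin m → PairModel M P, (∀ i, (v i).val ∈ P) →
        (γ.Realize v ↔ G fun i => (v i).val) := by
    intro M P hl v hv
    refine Iff.trans ?_ (hl.exists_notMem_mcl_iff h hκ hκmu φ _ hv).symm
    rw [realize_exLast]
    simp only [Formula.realize_inf, Formula.realize_not, realize_predFormula,
      realize_pairLift_elim, Sum.elim_inr]
    constructor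
    · rintro ⟨x, hx, hxP⟩
      exact ⟨x.val, x.val_mem, hxP, hx⟩
    · rintro ⟨x, hx, hxP, hφ⟩
      exact ⟨(⟨x, hx⟩ : M), hφ, hxP⟩
  let ν : Cardinal.{u} := max κ lam
  have hν : ℵ₀ ≤ ν := hκ.trans (le_max_left _ _)
  let a : ∀ s, ULift.{u} (Fin m) → PairModel (M s) (P s) := fun s i =>
    (⟨b' s i.down, (hl s).subset (hbP s (mem_range_self _))⟩ : M s)
  obtain ⟨N, _, _, a', hN, hNs, hNa⟩ := exists_saturated_of_eventually (L := pairLang L)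
    (N := fun s => PairModel (M s) (P s)) Filter.atTop a hν
    (card_pairLang_le hν (hL.trans (le_max_left _ _)))
    ((lt_aleph0_of_finite _).le.trans (hν.trans (cantor ν).le))
  have hNmu : #N < mu := hN.trans_lt
    (h.monster.strongLimit.isStrongPrelimit (max_lt hκmu hlam))
  have hNT : Theory.Model N T' := ⟨fun σ hσ => by
    refine (realize_relabel_sentence σ a').1 (hNa _ (Filter.Eventually.of_forall fun s => ?_))
    exact (realize_relabel_sentence σ _).2 ((hT' _ _ (hl s)).realize_of_mem σ hσ)⟩
  obtain ⟨M', P', hM', hP', ⟨e⟩⟩ := h.monster.exists_pair_equiv N hNmu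
    ⟨fun σ hσ => hNT.realize_of_mem σ (hTT' hσ)⟩
  have hl' : IsLovely mu ind κ M' P' := by
    refine hsat M' P' hM' hP' ⟨fun σ hσ => ?_⟩ ((hNs.mono
      ((le_max_right _ _).trans (Order.le_succ ν))).of_equiv e)
    exact (StrongHomClass.realize_sentence e σ).1 (hNT.realize_of_mem σ hσ)
  let w : Fin m → PairModel M' P' := fun i => e (a' ⟨i⟩)
  have hw : ∀ χ : (pairLang L).Formula (Fin m),
      (∀ᶠ s in Filter.atTop, χ.Realize fun i => a s ⟨i⟩) → χ.Realize w := by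
    intro χ hχ
    have := hNa (χ.relabel ULift.up) (hχ.mono fun s hs => Formula.realize_relabel.2 hs)
    rw [Formula.realize_relabel, ← StrongHomClass.realize_formula e] at this
    exact this
  have hwP : ∀ i, (w i).val ∈ P' := fun i => (realize_predFormula i w).1
    (hw _ (Filter.Eventually.of_forall fun s =>
      (realize_predFormula i _).2 (hbP s (mem_range_self i))))
  have hwb : ∀ θ : L.Formula (Fin m), θ.Realize b → θ.Realize fun i => (w i).val := by
    intro θ hθ
    rw [← realize_pairLift]
    refine hw _ ((Filter.eventually_ge_atTop {⟨θ, hθ⟩}).mono fun s hs => ?_)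
    rw [realize_pairLift]
    exact hb' s ⟨θ, hθ⟩ (Finset.singleton_subset_iff.1 hs)
  obtain ⟨σ, -, hσ⟩ := h.monster.exists_equiv_of_sameTypeFin (h.small_of_finite finite_empty)
    (a := b) (a' := fun i => (w i).val) (by
      intro θ
      have hr : ∀ d : Fin m → C, (θ.relabel (Sum.elim (fun x => absurd x.2 (notMem_empty _)) id) :
          L.Formula (Fin m)).Realize d ↔
            θ.Realize (Sum.elim (fun x : (∅ : Set C) => (x : C)) d) := by
        intro d
        rw [Formula.realize_relabel]
        have : d ∘ (Sum.elim (fun x => absurd x.2 (notMem_empty _)) id) =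
            Sum.elim (fun x : (∅ : Set C) => (x : C)) d := by
          ext (x | x)
          · exact absurd x.2 (notMem_empty _)
          · rfl
        rw [this]
      rw [← hr, ← hr]
      refine ⟨hwb _, fun hθ => by_contra fun hn => ?_⟩
      exact Formula.realize_not.1 (hwb _ (Formula.realize_not.2 hn)) hθ)
  have hGw : G (fun i => (w i).val) ↔ G b := by
    have hwσ : (fun i => (w i).val) = fun i => σ (b i) := funext fun i => (hσ i).symm
    have hrange : range (fun i => σ (b i)) = σ '' range b := range_comp σ b
    have hs := h.small_of_finite (finite_range b)
    have helim : ∀ c, (Sum.elim (fun i => σ (b i)) fun _ : Fin 1 => σ c) =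
        fun i => σ (Sum.elim b (fun _ => c) i) := by
      intro c
      ext (i | i) <;> rfl
    rw [hwσ]
    constructor
    · rintro ⟨c, hc, hφ⟩
      obtain ⟨c, rfl⟩ : ∃ d, σ d = c := ⟨σ.symm c, σ.apply_symm_apply c⟩
      rw [hrange, h.mem_mcl_image_iff hs] at hc
      rw [helim, realize_comp_equiv] at hφ
      exact ⟨c, hc, hφ⟩
    · rintro ⟨c, hc, hφ⟩
      refine ⟨σ c, ?_, ?_⟩
      · rwa [hrange, h.mem_mcl_image_iff hs]
      · rwa [helim, realize_comp_equiv]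
  have hγs : ∀ s, (γ.Realize fun i => a s ⟨i⟩) ↔ G (b' s) := fun s =>
    hγ _ _ (hl s) _ fun i => hbP s (mem_range_self i)
  by_cases hGb : G b
  · refine Formula.realize_not.1 (hw γ.not (Filter.Eventually.of_forall fun s =>
      Formula.realize_not.2 fun hγ' => hG s ?_)) ((hγ _ _ hl' w hwP).2 (hGw.2 hGb))
    exact iff_of_true ((hγs s).1 hγ') hGb
  · refine hGb (hGw.1 ((hγ _ _ hl' w hwP).1 (hw γ (Filter.Eventually.of_forall fun s =>
      (hγs s).2 ?_))))
    by_contra hn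
    exact hG s (iff_of_false hn hGb)

end IsRankOne

end FirstOrderImpliesDefinable

/-! ### Definability of the rank and of the closure imply first-order loveliness -/

section DefinableImpliesFirstOrder

variable {L : FirstOrder.Language.{u, u}} {C : Type u} [L.Structure C] {mu κ : Cardinal.{u}}
  {ind : Set C → Set C → Set C → Prop} {M : L.ElementarySubstructure C} {P : Set C}

/-- The common theory of all lovely pairs. -/
def lovelyTheory (L : FirstOrder.Language.{u, u}) {C : Type u} [L.Structure C] (mu κ : Cardinal.{u})
    (ind : Set C → Set C → Set C → Prop) : (pairLang L).Theory :=
  {σ | ∀ (M : L.ElementarySubstructure C) (P : Set C), IsLovely mu ind κ M P →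
    PairModel M P ⊨ σ}

/-- The inclusion of a subset of `M` in the universe of the pair `(M, P)`. -/
def PairModel.inclusion {A : Set C} (hA : A ⊆ M) : A → PairModel M P := fun x => (⟨x, hA x.2⟩ : M)

/-- A model of the theory of lovely pairs satisfies the universal closure of every formula that
holds everywhere in all lovely pairs. -/
theorem realize_of_model_lovelyTheory [Nonempty C]
    (hT : Theory.Model (PairModel M P) (lovelyTheory L mu κ ind)) {α : Type u}
    (θ : (pairLang L).Formula α)
    (hθ : ∀ (M : L.ElementarySubstructure C) (P : Set C), IsLovely mu ind κ M P →
      ∀ v : α → PairModel M P, θ.Realize v) (v : α → PairModel M P) : θ.Realize v := by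
  obtain ⟨σ, hσ⟩ := exists_sentence_iff_forall_realize.{u, u, u} θ
  exact (hσ _).1 (hT.realize_of_mem σ fun M P hl => (hσ _).2 (hθ M P hl)) v

theorem sameType₁_of_realize {A : Set C} {c d : C}
    (hcd : ∀ φ : L.Formula (A ⊕ Fin 1), φ.Realize (Sum.elim (↑) fun _ => c) →
      φ.Realize (Sum.elim (↑) fun _ => d)) : SameType₁ L A c d := fun φ =>
  ⟨hcd φ, fun hd => by_contra fun hn =>
    Formula.realize_not.1 (hcd φ.not (Formula.realize_not.2 hn)) hd⟩

namespace IsRankOne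

/-- In a saturated model of the theory of lovely pairs, an `L`-type over few elements is
realized. -/
theorem exists_sameType₁_of_isSaturated (hsat : IsSaturated (pairLang L) (PairModel M P) κ)
    {A : Set C} (hA : A ⊆ M) (hAκ : #A < κ) (c : C) : ∃ d ∈ M, SameType₁ L A c d := by
  classical
  let v : A → PairModel M P := PairModel.inclusion hA
  obtain ⟨d, hd⟩ := hsat.exists_realize hAκ v
    (pairLift '' {φ : L.Formula (A ⊕ Fin 1) | φ.Realize (Sum.elim (↑) fun _ => c)}) (by
      intro s hs
      obtain ⟨t, ht, rfl⟩ := Finset.subset_set_image_iff.1 hs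
      have hc : (exLast (conj t)).Realize (fun x : A => (x : C)) :=
        realize_exLast.2 ⟨c, realize_conj.2 fun φ hφ => ht hφ⟩
      obtain ⟨d, hd⟩ := realize_exLast.1 ((M.subtype.map_formula (exLast (conj t))
        (fun x : A => (⟨x, hA x.2⟩ : M))).1 hc)
      refine ⟨d, fun θ hθ => ?_⟩
      obtain ⟨φ, hφ, rfl⟩ := Finset.mem_image.1 hθ
      rw [pairLift, LHom.realize_onFormula]
      exact realize_conj.1 hd φ hφ)
  exact ⟨d.val, d.val_mem, sameType₁_of_realize fun φ hφ =>
    (realize_pairLift_elim φ v d).1 (hd _ (mem_image_of_mem _ hφ))⟩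

/-- If every type outside the closure of its parameters has in every lovely pair a realization with
the property `E`, then in a saturated model of the theory of lovely pairs it has a realization that
satisfies every first-order consequence of `E`. -/
theorem exists_sameType₁_of_generic (h : IsRankOne L mu ind) [Nonempty C]
    (hG : GenericDefinable L ind) (hκmu : κ < mu)
    (hT : Theory.Model (PairModel M P) (lovelyTheory L mu κ ind))
    (hsat : IsSaturated (pairLang L) (PairModel M P) κ)
    {A : Set C} (hA : A ⊆ M) (hAκ : #A < κ) {c : C} (hc : c ∉ mcl ind A)
    (E : ∀ (M : L.ElementarySubstructure C) (P : Set C), (A → PairModel M P) → PairModel M P → Prop)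
    (hE : ∀ (M : L.ElementarySubstructure C) (P : Set C), IsLovely mu ind κ M P →
      ∀ (v : A → PairModel M P) (c : C), c ∉ mcl ind (range fun i => (v i).val) →
        ∃ x, E M P v x ∧ SameType₁ L (range fun i => (v i).val) c x.val) :
    ∃ d : PairModel M P, SameType₁ L A c d.val ∧ ∀ θ : (pairLang L).Formula (A ⊕ Fin 1),
      (∀ (M : L.ElementarySubstructure C) (P : Set C), IsLovely mu ind κ M P →
        ∀ (v : A → PairModel M P) (x : PairModel M P), E M P v x →
          θ.Realize (Sum.elim v fun _ => x)) →
      θ.Realize (Sum.elim (PairModel.inclusion hA) fun _ => d) := by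
  classical
  let v₀ : A → PairModel M P := PairModel.inclusion hA
  -- The consequences of `E` and of a formula of the type, in all lovely pairs.
  let p : Set ((pairLang L).Formula (A ⊕ Fin 1)) :=
    {θ | ∃ ψ : L.Formula (A ⊕ Fin 1), ψ.Realize (Sum.elim (↑) fun _ => c) ∧
      ∀ (M : L.ElementarySubstructure C) (P : Set C), IsLovely mu ind κ M P →
        ∀ (v : A → PairModel M P) (x : PairModel M P), E M P v x →
          ψ.Realize (Sum.elim (fun i => (v i).val) fun _ => x.val) →
            θ.Realize (Sum.elim v fun _ => x)}
  obtain ⟨d, hd⟩ := hsat.exists_realize hAκ v₀ p (by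
    intro s hs
    choose! ψ hψ hψ' using hs
    let Ψ := conj (s.image ψ)
    obtain ⟨g, hg⟩ := h.exists_formula_generic hG (hAκ.trans hκmu) Ψ
    have hax := realize_of_model_lovelyTheory hT ((pairLift g).imp (exLast (conj s))) (by
      intro M P hl v
      rw [Formula.realize_imp, realize_pairLift, hg, realize_exLast]
      rintro ⟨c', hc', hΨ⟩
      obtain ⟨x, hx, hcx⟩ := hE M P hl v c' hc'
      refine ⟨x, realize_conj.2 fun θ hθ => hψ' hθ M P hl v x hx ?_⟩
      exact realize_conj.1 (hcx.realize_elim hΨ) _ (Finset.mem_image_of_mem ψ hθ)) v₀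
    rw [Formula.realize_imp, realize_pairLift, hg, realize_exLast] at hax
    obtain ⟨x, hx⟩ := hax ⟨c, by
      have : (range fun i => (v₀ i).val) = A := Subtype.range_coe
      rwa [this], realize_conj.2 fun θ hθ => by
      obtain ⟨θ', hθ', rfl⟩ := Finset.mem_image.1 hθ
      exact hψ hθ'⟩
    exact ⟨x, realize_conj.1 hx⟩)
  refine ⟨d, sameType₁_of_realize fun φ hφ => (realize_pairLift_elim φ v₀ d).1 (hd _
    ⟨φ, hφ, fun M P _ v x _ hx => (realize_pairLift_elim φ v x).2 hx⟩), fun θ hθ => hd θ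
    ⟨⊤, by simp, fun M P hl v x hx _ => hθ M P hl v x hx⟩⟩

/-- A saturated model of the theory of lovely pairs is lovely.  Definability of the closure and of
the generic quantifier allow the theory to speak about membership in the closure of the predicate
and to distinguish generic types. -/
theorem isLovely_of_isSaturated (h : IsRankOne L mu ind) [Nonempty C] (hG : GenericDefinable L ind)
    (hcl : ClosureDefinable L mu ind) (hκ : ℵ₀ ≤ κ) (hκmu : κ < mu)
    (hM : IsSmall mu (M : Set C)) (hP : P ⊆ M)
    (hT : Theory.Model (PairModel M P) (lovelyTheory L mu κ ind))
    (hsat : IsSaturated (pairLang L) (PairModel M P) κ) : IsLovely mu ind κ M P := by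
  classical
  have hPs : IsSmall mu P := hM.mono hP
  have hrange : ∀ {A : Set C} {M : L.ElementarySubstructure C} {P : Set C}, #A < κ →
      ∀ v : A → PairModel M P, #(range fun i => (v i).val) < κ ∧
        (range fun i => (v i).val) ⊆ (M : Set C) := fun hAκ v =>
    ⟨mk_range_le.trans_lt hAκ, range_subset_iff.2 fun i => (v i).val_mem⟩
  refine ⟨hM, hP, ?_, ?_⟩
  · intro A hA hAκ c hi
    have hAs : IsSmall mu A := hAκ.trans hκmu
    by_cases hc : c ∈ mcl ind A
    · have hPA : IsSmall mu (P ∩ A) := hAs.mono inter_subset_right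
      have hc' : c ∈ mcl ind (P ∩ A) := by
        by_contra hn
        exact h.notMem_mcl_of_ind hPA hAs inter_subset_right hi hn hc
      obtain ⟨A₀, hA₀, hf, hc₀⟩ := h.exists_finite_of_mem_mcl hPA hc'
      have := hf.to_subtype
      obtain ⟨S, hS, hcS, hScl⟩ := hcl A₀ (h.small_of_finite hf) c hc₀
      obtain ⟨χ, hχ⟩ := definable_iff_exists_formula_sum.1 hS
      have hχS : ∀ x, χ.Realize (Sum.elim (↑) fun _ => x) ↔ x ∈ S := fun x =>
        (Set.ext_iff.1 hχ fun _ => x).symm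
      obtain ⟨g, hg⟩ := h.exists_formula_generic hG (h.small_of_finite hf) χ
      obtain ⟨d, hd, hcd⟩ := exists_sameType₁_of_isSaturated hsat hA hAκ c
      refine ⟨d, ?_, hcd⟩
      have hdS : d ∈ S :=
        (hχS d).1 (((hcd.mono (hA₀.trans inter_subset_right)) χ).1 ((hχS c).2 hcS))
      -- In a lovely pair, if `y` belongs to the predicate and `χ(y, C)` has no point outside the
      -- closure of `y`, then every point of `χ(y, M)` belongs to the predicate.
      let v : A₀ ⊕ Fin 1 → PairModel M P :=
        Sum.elim (PairModel.inclusion fun x hx => hP (hA₀ hx).1) fun _ => (⟨d, hd⟩ : M)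
      have hax := realize_of_model_lovelyTheory hT
        ((Formula.iInf fun y : A₀ => predFormula L (Sum.inl y)).imp
          ((pairLift χ).imp ((pairLift g).relabel Sum.inl ⊔ predFormula L (Sum.inr 0)))) (by
          intro M P hl v
          simp only [Formula.realize_imp, Formula.realize_iInf, realize_predFormula,
            realize_pairLift, Formula.realize_sup, Formula.realize_relabel, hg]
          intro hvP hχv
          have hv : (fun i => (v i).val) =
              Sum.elim (fun y => (v (Sum.inl y)).val) fun _ => (v (Sum.inr 0)).val := by
            ext (y | i)
            · rfl
            · rw [Subsingleton.elim i 0]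
              rfl
          rw [hv] at hχv
          by_cases hx : (v (Sum.inr 0)).val ∈ mcl ind (range fun y => (v (Sum.inl y)).val)
          · exact Or.inr (hl.mem_of_mem_mcl h hκ (v (Sum.inr 0)).val_mem
              (h.mcl_mono hl.small_pred (range_subset_iff.2 hvP) hx))
          · exact Or.inl ⟨_, hx, hχv⟩) v
      simp only [Formula.realize_imp, Formula.realize_iInf, realize_predFormula,
        Formula.realize_sup, Formula.realize_relabel] at hax
      rcases hax (fun y => (hA₀ y.2).1)
        ((realize_pairLift_elim χ _ _).2 ((hχS d).2 hdS)) with hgd | hdP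
      · obtain ⟨x, hx, hχx⟩ := (hg _).1 ((realize_pairLift g _).1 hgd)
        have hr : (range fun i : A₀ => ((v ∘ Sum.inl) i).val) = A₀ := Subtype.range_coe
        exact absurd (hScl ((hχS x).1 hχx)) (hr ▸ hx)
      · exact hdP
    · obtain ⟨d, hcd, hd⟩ := h.exists_sameType₁_of_generic hG hκmu hT hsat hA hAκ hc
        (fun _ P _ x => x.val ∈ P) (by
          intro M P hl v c hc
          obtain ⟨d, hd, hcd⟩ := hl.exists_mem_pred h hκmu (hrange hAκ v).2 (hrange hAκ v).1 hc
          exact ⟨(⟨d, hl.subset hd⟩ : M), hd, hcd⟩)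
      exact ⟨d.val, (realize_predFormula _ _).1 (hd (predFormula L (Sum.inr 0))
        fun M P _ v x hx => (realize_predFormula _ _).2 hx), hcd⟩
  · intro A hA hAκ c
    have hAs : IsSmall mu A := hAκ.trans hκmu
    by_cases hc : c ∈ mcl ind A
    · obtain ⟨d, hd, hcd⟩ := exists_sameType₁_of_isSaturated hsat hA hAκ c
      exact ⟨d, hd, hcd, h.ind_of_mem_mcl hAs hPs ((h.mem_mcl_iff_of_sameType₁ hAs hcd).1 hc)⟩
    · obtain ⟨d, hcd, hd⟩ := h.exists_sameType₁_of_generic hG hκmu hT hsat hA hAκ hc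
        (fun _ P v x => x.val ∉ mcl ind ((range fun i => (v i).val) ∪ P)) (by
          intro M P hl v c hc
          obtain ⟨d, hd, hcd, hdP⟩ :=
            hl.exists_notMem_mcl h hκmu (hrange hAκ v).2 (hrange hAκ v).1 hc
          exact ⟨(⟨d, hd⟩ : M), hdP, hcd⟩)
      have hAP := hAs.union h.le_mu hPs
      refine ⟨d.val, d.val_mem, hcd, h.ind_mono_right (h.small_singleton _) hAs hAP
        (h.ind_of_notMem_mcl hAP subset_union_left fun hdcl => ?_) subset_union_right⟩
      -- If `d` were in the closure of `A ∪ P`, it would be in the closure of `A` and a finite tuple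
      -- `z` of the predicate, and a definable set would witness this.
      obtain ⟨S₀, hS₀, hf, hdS₀⟩ := h.exists_finite_of_mem_mcl hAP hdcl
      obtain ⟨r, z, hz⟩ : ∃ (r : ℕ) (z : Fin r → C), range z = S₀ ∩ P := by
        have hfP := hf.inter_of_left P
        have := hfP.to_subtype
        obtain ⟨r, ⟨e⟩⟩ := Finite.exists_equiv_fin ↥(S₀ ∩ P)
        exact ⟨r, fun i => e.symm i, by
          rw [show (fun i => ((e.symm i : ↥(S₀ ∩ P)) : C)) = Subtype.val ∘ e.symm from rfl,
            e.symm.surjective.range_comp, Subtype.range_coe]⟩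
      have hzP : ∀ i, z i ∈ P := fun i => (hz ▸ mem_range_self i : z i ∈ S₀ ∩ P).2
      have hAz : IsSmall mu (A ∪ range z) := hAs.union h.le_mu (h.small_of_finite (finite_range z))
      have hdz : d.val ∈ mcl ind (A ∪ range z) := h.mcl_mono hAz (fun x hx => by
        rw [hz]
        exact (hS₀ hx).imp id fun hxP => ⟨hx, hxP⟩) hdS₀
      obtain ⟨S, hS, hdS, hScl⟩ := hcl _ hAz _ hdz
      obtain ⟨χ, hχ⟩ := definable_iff_exists_formula_sum.1 hS
      let w : A ⊕ Fin r → C := Sum.elim (↑) z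
      have hw : range w = A ∪ range z := by
        rw [Sum.elim_range, Subtype.range_coe]
      choose k hk using fun x : ↥(A ∪ range z) => hw.ge x.2
      let χ' : L.Formula ((A ⊕ Fin r) ⊕ Fin 1) := χ.relabel (Sum.map k id)
      have hχS : ∀ x, χ'.Realize (Sum.elim w fun _ => x) ↔ x ∈ S := by
        intro x
        rw [Formula.realize_relabel, Sum.elim_comp_map, Function.comp_id,
          show w ∘ k = fun x : ↥(A ∪ range z) => (x : C) from funext hk]
        exact (Set.ext_iff.1 hχ fun _ => x).symm
      have hι : #(A ⊕ Fin r) < mu := by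
        simpa using add_lt_of_lt h.le_mu hAs ((natCast_lt_aleph0 (n := r)).trans_le h.le_mu)
      obtain ⟨g, hg⟩ := h.exists_formula_generic hG hι χ'
      -- The formula "`x` does not belong to a set `χ'(y, z, C)` in the closure of `y, z`, for `z`
      -- in the predicate".
      let ρ : (A ⊕ Fin r) ⊕ Fin 1 → (A ⊕ Fin 1) ⊕ Fin r :=
        Sum.elim (Sum.map Sum.inl id) fun _ => Sum.inl (Sum.inr 0)
      let θ : (pairLang L).Formula (A ⊕ Fin 1) := Formula.iAlls (Fin r)
        ((Formula.iInf fun i : Fin r => predFormula L (Sum.inr i)).imp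
          (((pairLift χ').relabel ρ).imp ((pairLift g).relabel (ρ ∘ Sum.inl))))
      have hθ : ∀ (M : L.ElementarySubstructure C) (P : Set C) (v : A → PairModel M P)
          (x : PairModel M P), θ.Realize (Sum.elim v fun _ => x) ↔
            ∀ y : Fin r → PairModel M P, (∀ i, (y i).val ∈ P) →
              χ'.Realize (Sum.elim (Sum.elim (fun i => (v i).val) fun i => (y i).val)
                fun _ => x.val) →
              g.Realize (Sum.elim (fun i => (v i).val) fun i => (y i).val) := by
        intro M P v x
        have hρ₁ : ∀ y : Fin r → PairModel M P, (fun i =>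
            ((Sum.elim (Sum.elim v fun _ => x) y ∘ ρ) i).val) =
              Sum.elim (Sum.elim (fun i => (v i).val) fun i => (y i).val) fun _ => x.val := by
          intro y
          ext ((i | i) | i) <;> rfl
        have hρ₂ : ∀ y : Fin r → PairModel M P, (fun i =>
            ((Sum.elim (Sum.elim v fun _ => x) y ∘ (ρ ∘ Sum.inl)) i).val) =
              Sum.elim (fun i => (v i).val) fun i => (y i).val := by
          intro y
          ext (i | i) <;> rfl
        simp only [θ, Formula.realize_iAlls, Formula.realize_imp, Formula.realize_iInf,
          realize_predFormula, Formula.realize_relabel, realize_pairLift, hρ₁, hρ₂, Sum.elim_inr]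
      have hdθ := (hθ _ _ _ _).1 (hd θ (by
        intro M P hl v x hx
        rw [hθ]
        intro y hy hχ
        refine (hg _).2 ⟨x.val, mt (fun hxcl => h.mcl_mono ?_ ?_ hxcl) hx, hχ⟩
        · exact IsSmall.union h.le_mu ((hrange hAκ v).1.trans hκmu) hl.small_pred
        · rw [Sum.elim_range]
          exact union_subset_union_right _ (range_subset_iff.2 hy)))
        (fun i => (⟨z i, hP (hzP i)⟩ : M)) hzP ((hχS _).2 hdS)
      obtain ⟨x, hx, hχx⟩ := (hg _).1 hdθ
      exact absurd (hScl ((hχS x).1 hχx)) (hw ▸ hx)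

/-- The common theory of all lovely pairs witnesses that loveliness is first-order. -/
theorem lovelinessFirstOrder_of_genericDefinable (h : IsRankOne L mu ind) [Nonempty C]
    (hG : GenericDefinable L ind) (hcl : ClosureDefinable L mu ind) (hκ : ℵ₀ ≤ κ)
    (hκmu : κ < mu) : LovelinessFirstOrder L mu ind κ := by
  refine ⟨lovelyTheory L mu κ ind, ?_, fun M P hl => ⟨fun σ hσ => hσ M P hl⟩, κ, hκmu,
    fun M P hM hP hT hsat => h.isLovely_of_isSaturated hG hcl hκ hκmu hM hP hT hsat⟩
  rintro _ ⟨σ, hσ, rfl⟩ M P -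
  rw [LHom.realize_onSentence]
  exact (M.realize_sentence σ).2 hσ

end IsRankOne

end DefinableImpliesFirstOrder

end LovelyPairs

theorem mainTheorem9 (L : FirstOrder.Language.{u, u}) (C : Type u) [L.Structure C]
    (mu κ : Cardinal.{u}) (ind : Set C → Set C → Set C → Prop)
    (hC : LovelyPairs.IsMonster L C mu)
    (hind : LovelyPairs.IsIndependenceRelation L mu ind)
    (hsup : LovelyPairs.IsSuperior mu ind)
    (hrank : LovelyPairs.uRankSet L mu ind (Set.univ : Set (Fin 1 → C)) ∅ = 1)
    (hκ : max (LovelyPairs.kappaZero mu ind) (LovelyPairs.theoryCard L) < κ) (hκ' : κ < mu) :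
    (LovelyPairs.LovelinessFirstOrder L mu ind κ → LovelyPairs.UDefinable L mu ind) ∧
    (LovelyPairs.ClosureDefinable L mu ind →
      (LovelyPairs.LovelinessFirstOrder L mu ind κ ↔ LovelyPairs.UDefinable L mu ind)) := by
  have h : LovelyPairs.IsRankOne L mu ind := ⟨hC, hind,
    LovelyPairs.superior_of_isSuperior hsup, LovelyPairs.dichotomy_of_uRankSet hC hind hrank⟩
  have hcard : LovelyPairs.theoryCard L < κ := (le_max_right _ _).trans_lt hκ
  have hκ₀ : ℵ₀ ≤ κ := (le_max_left _ _).trans hcard.le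
  have hL : L.card ≤ κ := (le_max_right _ _).trans hcard.le
  -- The rank of the empty set is not 1.
  have : Nonempty C := by
    by_contra hne
    rw [not_nonempty_iff] at hne
    simp [LovelyPairs.uRankSet] at hrank
  have h₁ : LovelyPairs.LovelinessFirstOrder L mu ind κ → LovelyPairs.UDefinable L mu ind :=
    fun hfo => h.uDefinable_of_genericDefinable
      (h.genericDefinable_of_lovelinessFirstOrder hκ₀ hL hκ' hfo)
  exact ⟨h₁, fun hcl => ⟨h₁, fun hU => h.lovelinessFirstOrder_of_genericDefinable
    (h.genericDefinable_of_uDefinable hU) hcl hκ₀ hκ'⟩⟩
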